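/- Let $(V,Y,\mathbf 1)$ be a vertex algebra over $\mathbb C$ with modes $Y(v,x)=\sum_{n\in\mathbb Z}v_n x^{-n-1}$, and suppose that it is $\mathbb C$-graded: $V=\bigoplus_{\lambda\in\mathbb C}V_\lambda$, $\mathbf 1\in V_0$, and $v_nV_\lambda\subseteq V_{\lambda+\gamma-n-1}$ for $v\in V_\gamma$, $n\in\mathbb Z$; write $|v|=\lambda$ for $v\in V_\lambda$. Let $\Omega(V)$ be the set of all $v\in V$ such that, whenever $u\in V_\gamma$, $n\in\mathbb Z$ and $u_nv\neq0$, either $n=\gamma-1$ or $n<\operatorname{Re}(\gamma)-1$. Suppose that $V$ is an $\Omega$-generated $\mathbb C_{Re>0}$-graded vertex algebra, i.e. that $V$ is spanned by the elements $v^k_{n_k}\cdots v^1_{n_1}u^0$ with $k\ge 0$, $v^j\in V$, $n_j\in\mathbb Z$, $u^0\in\Omega(V)$, and that the degree $\deg(v^k_{n_k}\cdots v^1_{n_1}u^0)=\sum_j(|v^j|-n_j-1)$ (for homogeneous $v^j$) is well defined, in the sense that the sum of the spaces $V(d)$, $d\in\mathbb C$, spanned by the elements of this form of degree $d$, is direct.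 For $r\in\mathbb C$ let $V^r$ be the span of the homogeneous $v$ with $|v|-\lceil\operatorname{Re}|v|\rceil=r$. Let $\circ$ and $*$ be the bilinear products on $V$ given, for homogeneous $u\in V^r$ and $v\in V$, by $$u\circ v=\operatorname{Res}_z\frac{(1+z)^{\lceil\operatorname{Re}|u|\rceil+\delta_{r,0}-1}}{z^{1+\delta_{r,0}}}Y(u,z)v,\qquad u*v=\delta_{r,0}\operatorname{Res}_z\frac{(1+z)^{|u|}}{z}Y(u,z)v,$$ let $O(V)$ be the span of all $u\circ v$ with $u,v\in V$, let $A(V)=V/O(V)$, and put $$F_tA(V)=\Big(\bigoplus_{j=0}^tV_j+O(V)\Big)/O(V)\quad(t\in\mathbb N),\qquad F_{-1}A(V)=0,\qquad grA(V)=\bigoplus_{t\ge0}F_tA(V)/F_{t-1}A(V).$$ Assume that $V^0=\bigoplus_{n=0}^\infty V_n$. Then $*$ induces on $A(V)$ a well-defined associative product with unit $\mathbf 1+O(V)$; the spaces $F_tA(V)$ form an increasing exhaustive filtration of $A(V)$, which is multiplicative, i.e. $F_sA(V)*F_tA(V)\subseteq F_{s+t}A(V)$ for all $s,t\in\mathbb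 N$; and the induced product on $grA(V)$, under which the classes of $a\in F_sA(V)$ and $b\in F_tA(V)$ have as product the class of $a*b$ in $F_{s+t}A(V)/F_{s+t-1}A(V)$, is well defined and makes $grA(V)$ a commutative associative algebra, with unit the class of $\mathbf 1$. -/

import Mathlib

open scoped DirectSum

/-- A vertex algebra over `ℂ`. The state-field correspondence `v ↦ Y(v, x) = ∑ vₙ x^{-n-1}` takes
values in Mathlib's `VertexOperator`s, i.e. linear maps `V → V((x))`, so that the lower truncation
condition is part of the type. The Jacobi identity is stated as the equality of the coefficients of
`x₀^{-l-1} x₁^{-m-1} x₂^{-n-1}`; all three sums are finite by lower truncation. -/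
structure VertexAlgebra (V : Type*) [AddCommGroup V] [Module ℂ V] where
  /-- The state-field correspondence. -/
  Y : V →ₗ[ℂ] VertexOperator ℂ V
  /-- The vacuum vector. -/
  vac : V
  /-- `Y(𝟏, x)` is the identity. -/
  vacuum : ∀ (n : ℤ) (w : V), VertexOperator.ncoeff (Y vac) n w = if n = -1 then w else 0
  /-- `Y(v, x)𝟏` has no negative powers of `x`. -/
  creation_nonneg : ∀ (v : V) (n : ℤ), 0 ≤ n → VertexOperator.ncoeff (Y v) n vac = 0
  /-- The constant term of `Y(v, x)𝟏` is `v`. -/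
  creation_neg_one : ∀ v : V, VertexOperator.ncoeff (Y v) (-1) vac = v
  /-- The Jacobi identity. -/
  jacobi : ∀ (u v w : V) (l m n : ℤ),
    (∑ᶠ i : ℕ, ((-1 : ℤ) ^ i * Ring.choose l i) •
        VertexOperator.ncoeff (Y u) (m + l - i) (VertexOperator.ncoeff (Y v) (n + i) w))
      - (∑ᶠ i : ℕ, (((-1 : ℤˣ) ^ l : ℤˣ) * ((-1 : ℤ) ^ i * Ring.choose l i)) •
        VertexOperator.ncoeff (Y v) (n + l - i) (VertexOperator.ncoeff (Y u) (m + i) w))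
      = ∑ᶠ i : ℕ, (Ring.choose m i : ℤ) •
        VertexOperator.ncoeff (Y (VertexOperator.ncoeff (Y u) (l + i) v)) (m + n - i) w

namespace VertexAlgebra

variable {V : Type*} [AddCommGroup V] [Module ℂ V] (A : VertexAlgebra V)

/-- The mode `uₙ ∈ End V`, the coefficient of `x^{-n-1}` in `Y(u, x)`. -/
noncomputable def mode (u : V) (n : ℤ) : V →ₗ[ℂ] V := VertexOperator.ncoeff (A.Y u) n

theorem mode_add (u u' v : V) (n : ℤ) :
    A.mode (u + u') n v = A.mode u n v + A.mode u' n v := by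
  simp [mode]

theorem mode_smul (c : ℂ) (u v : V) (n : ℤ) :
    A.mode (c • u) n v = c • A.mode u n v := by
  simp [mode]

/-- Lower truncation. -/
theorem exists_mode_eq_zero (u v : V) : ∃ N : ℤ, ∀ n : ℤ, N ≤ n → A.mode u n v = 0 := by
  refine ⟨-(HahnSeries.order ((HahnModule.of ℂ).symm (A.Y u v))), fun n hn => ?_⟩
  exact VertexOperator.ncoeff_eq_zero_of_lt_order _ _ _ (by lia)

theorem finite_support_mode (a b : ℤ) (u v : V) :
    (Function.support fun i : ℕ => Ring.choose a i • A.mode u (i - b) v).Finite := by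
  obtain ⟨N, hN⟩ := A.exists_mode_eq_zero u v
  refine (Set.finite_lt_nat (N + b).toNat).subset fun i hi => ?_
  by_contra h
  apply hi
  simp only [Set.mem_ofPred_eq, not_lt] at h
  simp [hN (i - b) (by lia)]

/-- The residue `Res_z (1 + z)^a z^{-b} Y(u, z) v = ∑_{i ≥ 0} (a choose i) u_{i-b} v`, as a bilinear
map in `(u, v)`. -/
noncomputable def res (a b : ℤ) : V →ₗ[ℂ] V →ₗ[ℂ] V :=
  LinearMap.mk₂ ℂ (fun u v => ∑ᶠ i : ℕ, Ring.choose a i • A.mode u (i - b) v)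
    (fun u u' v => by
      rw [← finsum_add_distrib (A.finite_support_mode a b u v) (A.finite_support_mode a b u' v)]
      simp only [mode_add, smul_add])
    (fun c u v => by
      rw [smul_finsum' c (A.finite_support_mode a b u v)]
      simp only [mode_smul, smul_comm c])
    (fun u v v' => by
      rw [← finsum_add_distrib (A.finite_support_mode a b u v) (A.finite_support_mode a b u v')]
      simp only [map_add, smul_add])
    (fun c u v => by
      rw [smul_finsum' c (A.finite_support_mode a b u v)]
      simp only [map_smul, smul_comm c])

end VertexAlgebra

/-- A `ℂ`-graded vertex algebra: `V = ⨁_{lam ∈ ℂ} V_lam` with `𝟏 ∈ V_0` and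
`vₙ V_lam ⊆ V_{lam + gam - n - 1}` for `v ∈ V_gam`. -/
structure CGradedVertexAlgebra (V : Type*) [AddCommGroup V] [Module ℂ V] extends
    VertexAlgebra V where
  /-- The weight spaces. -/
  wt : ℂ → Submodule ℂ V
  isInternal : DirectSum.IsInternal wt
  vac_mem : vac ∈ wt 0
  mode_mem : ∀ (gam lam : ℂ) (n : ℤ) (v w : V), v ∈ wt gam → w ∈ wt lam →
    toVertexAlgebra.mode v n w ∈ wt (lam + gam - n - 1)

namespace CGradedVertexAlgebra

variable {V : Type*} [AddCommGroup V] [Module ℂ V] (A : CGradedVertexAlgebra V)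

/-- `Ω(V)`, the vectors annihilated by all modes that lower the real part of the weight. -/
def Omega : Set V :=
  {v | ∀ (gam : ℂ) (u : V) (n : ℤ), u ∈ A.wt gam → A.mode u n v ≠ 0 →
    (n : ℂ) = gam - 1 ∨ (n : ℝ) < gam.re - 1}

/-- Elements of the form `v^k_{n_k} ⋯ v^1_{n_1} u⁰` with `u⁰ ∈ Ω(V)`. -/
inductive OmegaWord : V → Prop
  | base (u : V) (hu : u ∈ A.Omega) : OmegaWord u
  | step (v w : V) (n : ℤ) (hw : OmegaWord w) : OmegaWord (A.mode v n w)

/-- `V` is `Ω`-generated. -/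
def IsOmegaGenerated : Prop := Submodule.span ℂ {v | A.OmegaWord v} = ⊤

/-- `OmegaWordDeg d x`: `x = v^k_{n_k} ⋯ v^1_{n_1} u⁰` with `u⁰ ∈ Ω(V)`, with homogeneous `v^j`, and
with `d = ∑_j (|v^j| - n_j - 1)`. -/
inductive OmegaWordDeg : ℂ → V → Prop
  | base (u : V) (hu : u ∈ A.Omega) : OmegaWordDeg 0 u
  | step (d gam : ℂ) (v w : V) (n : ℤ) (hv : v ∈ A.wt gam) (hw : OmegaWordDeg d w) :
      OmegaWordDeg (d + (gam - n - 1)) (A.mode v n w)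

/-- The space `V(d)` of elements of degree `d`. -/
def degSpace (d : ℂ) : Submodule ℂ V := Submodule.span ℂ {x | A.OmegaWordDeg d x}

/-- The degree is well defined: the sum of the spaces `V(d)`, `d ∈ ℂ`, is direct. -/
def DegreeWellDefined : Prop := iSupIndep A.degSpace

/-- `V` is an `Ω`-generated `ℂ_{Re>0}`-graded vertex algebra. -/
def IsOmegaGeneratedReGraded : Prop := A.IsOmegaGenerated ∧ A.DegreeWellDefined

/-- `V^r`, the span of the homogeneous `v` with `|v| - ⌈Re |v|⌉ = r`. -/
def part (r : ℂ) : Submodule ℂ V :=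
  Submodule.span ℂ {v | ∃ lam : ℂ, v ∈ A.wt lam ∧ r = lam - (⌈lam.re⌉ : ℤ)}

/-- The bilinear extension to `V` of products `u, v ↦ f lam u v` given for `u ∈ V_lam`, `v ∈ V`. -/
noncomputable def extend (f : ℂ → V →ₗ[ℂ] V →ₗ[ℂ] V) : V →ₗ[ℂ] V →ₗ[ℂ] V :=
  DirectSum.toModule ℂ ℂ (V →ₗ[ℂ] V) (fun lam => (f lam) ∘ₗ (A.wt lam).subtype) ∘ₗ
    (LinearEquiv.ofBijective (DirectSum.coeLinearMap A.wt) A.isInternal).symm.toLinearMap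

open Classical in
/-- `δ_{r,0}` for `r = lam - ⌈Re lam⌉`. -/
noncomputable def delta (lam : ℂ) : ℤ := if lam - (⌈lam.re⌉ : ℤ) = 0 then 1 else 0

/-- The product `∘`: for `u ∈ V_lam` it is `Res_z (1+z)^{⌈Re lam⌉+δ-1} z^{-(1+δ)} Y(u,z)v`. -/
noncomputable def circ : V →ₗ[ℂ] V →ₗ[ℂ] V :=
  A.extend fun lam => A.res (⌈lam.re⌉ + delta lam - 1) (1 + delta lam)

/-- The product `*`: for `u ∈ V_lam` it is `δ Res_z (1+z)^{lam} z^{-1} Y(u,z)v`; where `δ ≠ 0` the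
weight `lam` is the integer `⌈Re lam⌉`. -/
noncomputable def star : V →ₗ[ℂ] V →ₗ[ℂ] V :=
  A.extend fun lam => delta lam • A.res ⌈lam.re⌉ 1

/-- `O(V)`, the span of all `u ∘ v`. -/
def zhuO : Submodule ℂ V := Submodule.span ℂ {x | ∃ u v : V, x = A.circ u v}

/-- The vector space `A(V) = V / O(V)`. -/
abbrev Zhu : Type _ := V ⧸ A.zhuO

/-- The class `[v] = v + O(V)`. -/
abbrev cls (v : V) : A.Zhu := A.zhuO.mkQ v

/-- `F_t A(V) = (⨁_{j=0}^t V_j + O(V)) / O(V)`. -/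
def fil (t : ℕ) : Submodule ℂ A.Zhu := (⨆ (j : ℕ) (_ : j ≤ t), A.wt (j : ℂ)).map A.zhuO.mkQ

/-- `F_{t-1} A(V)`, with `F_{-1} A(V) = 0`. -/
def filPred : ℕ → Submodule ℂ A.Zhu
  | 0 => ⊥
  | t + 1 => A.fil t

/-- `gr_t A(V) = F_t A(V) / F_{t-1} A(V)`. -/
abbrev grPiece (t : ℕ) : Type _ := A.fil t ⧸ (A.filPred t).comap (A.fil t).subtype

/-- `gr A(V) = ⨁_t gr_t A(V)`. -/
abbrev gr : Type _ := ⨁ t : ℕ, A.grPiece t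

/-- The class in `gr_t A(V) ⊆ gr A(V)` of an element of `F_t A(V)`. -/
noncomputable def symb (t : ℕ) (a : A.fil t) : A.gr :=
  DirectSum.lof ℂ ℕ A.grPiece t (((A.filPred t).comap (A.fil t).subtype).mkQ a)

theorem cls_vac_mem : A.cls A.vac ∈ A.fil 0 := by
  refine Submodule.mem_map_of_mem (Submodule.mem_iSup_of_mem 0 (Submodule.mem_iSup_of_mem le_rfl ?_))
  simpa using A.vac_mem

end CGradedVertexAlgebra

/-! This is Zhu's argument, written with residues Res_z f(z) Y(u, z) v (`smear`) against the series
f = (1+z)^p z^q. Testing the Jacobi identity against such series gives the commutator and associator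
formulas; together with translation covariance and skew symmetry they carry the proof.

A vector u of non-integral weight satisfies u ∘ 𝟏 = u and so dies in A(V) (`wt_le_zhuO`). Only
integral weights matter, and the hypothesis on V^0 excludes the negative ones. For u of weight k,
passing to its derivative shows that O(V) contains all residues against (1+z)^k z^{-2-n}. The
associator formula then writes (a*b)*c as a*(b*c) plus residues of this kind (`cls_star_assoc`).

By the commutator formula, O(V) is stable under residues of Y(c, z), |c| = k, against (1+z)^k z^{-1}
and (1+z)^{k-1} (`smear_mem_zhuO_of_mem_zhuO`); the first is left multiplication. Skew symmetry and
Vandermonde's identity give u*v ≡ v*u - Res (1+z)^{t-1} Y(v, z)u for |v| = t (`cls_star_sub_star`).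
With the second stability, this makes O(V) stable under right multiplication. It also makes gr A(V)
commutative: the correction involves only v_n u with n ≥ 0, of weight at most |u| + |v| - 1.
Likewise u*v involves only modes n ≥ -1, so the filtration is multiplicative. -/

namespace LaurentSeries

/-! ### The Laurent series (1+z)^p z^q and their derivatives -/

open HahnSeries Finset

/-- The Laurent series `(1 + z)^p z^q`. -/
noncomputable def onePlusPow (p q : ℤ) : LaurentSeries ℂ :=
  single q 1 * ofPowerSeries ℤ ℂ (PowerSeries.binomialSeries ℂ p)

theorem onePlusPow_mul (p q p' q' : ℤ) :
    onePlusPow p q * onePlusPow p' q' = onePlusPow (p + p') (q + q') := by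
  simp only [onePlusPow, PowerSeries.binomialSeries_add, map_mul]
  rw [mul_mul_mul_comm, single_mul_single, one_mul]

theorem coeff_onePlusPow_of_lt {p q n : ℤ} (h : n < q) : (onePlusPow p q).coeff n = 0 := by
  rw [onePlusPow, coeff_single_mul, one_mul, PowerSeries.coeff_coe, if_pos (by lia)]

theorem coeff_onePlusPow_add (p q : ℤ) (i : ℕ) :
    (onePlusPow p q).coeff (q + i) = Ring.choose p i := by
  rw [onePlusPow, coeff_single_mul, one_mul, add_sub_cancel_left, coeff_coe_powerSeries]
  simp

theorem onePlusPow_zero (q : ℤ) : onePlusPow 0 q = single q 1 := by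
  simp [onePlusPow]

theorem single_mul_onePlusPow (p q r : ℤ) :
    single r 1 * onePlusPow p q = onePlusPow p (r + q) := by
  rw [← onePlusPow_zero, onePlusPow_mul, zero_add]

theorem onePlusPow_succ (p q : ℤ) :
    onePlusPow (p + 1) q = onePlusPow p q + onePlusPow p (q + 1) := by
  have h : onePlusPow 1 0 = onePlusPow 0 0 + onePlusPow 0 1 := by
    rw [onePlusPow_zero, onePlusPow_zero, onePlusPow]
    have := PowerSeries.binomialSeries_nat (R := ℤ) (A := ℂ) 1
    rw [Nat.cast_one, pow_one] at this
    rw [this]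
    simp
  have := congrArg (onePlusPow p q * ·) h
  simpa only [mul_add, onePlusPow_mul, add_zero] using this

theorem derivative_onePlusPow (p q : ℤ) :
    hasseDeriv ℂ 1 (onePlusPow p q) =
      (p : ℂ) • onePlusPow (p - 1) q + (q : ℂ) • onePlusPow p (q - 1) := by
  ext n
  rw [hasseDeriv_coeff, coeff_add, coeff_smul, coeff_smul, Nat.cast_one, Ring.choose_one_right]
  rcases lt_trichotomy (n + 1) q with h | h | h
  · rw [coeff_onePlusPow_of_lt h, coeff_onePlusPow_of_lt (by lia), coeff_onePlusPow_of_lt (by lia)]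
    simp
  · subst h
    have h1 := coeff_onePlusPow_add p (n + 1) 0
    have h2 := coeff_onePlusPow_add p n 0
    simp only [Nat.cast_zero, add_zero] at h1 h2
    rw [h1, coeff_onePlusPow_of_lt (by lia), add_sub_cancel_right, h2]
    simp
  · obtain ⟨i, rfl⟩ : ∃ i : ℕ, n = q + i := ⟨(n - q).toNat, by lia⟩
    have h1 := coeff_onePlusPow_add p q (i + 1)
    have h2 := coeff_onePlusPow_add p (q - 1) (i + 1)
    have h3 := Ring.choose_smul_choose p (Nat.le_add_left 1 i)
    rw [Nat.choose_one_right, Ring.choose_one_right] at h3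
    have h4 : ((i : ℂ) + 1) * (Ring.choose p (i + 1) : ℤ) = p * (Ring.choose (p - 1) i : ℤ) := by
      have := congrArg (Int.cast (R := ℂ)) h3
      simpa using this
    rw [show q + (i : ℤ) + 1 = q + ((i + 1 : ℕ) : ℤ) by push_cast; ring, h1,
      coeff_onePlusPow_add, show q + (i : ℤ) = q - 1 + ((i + 1 : ℕ) : ℤ) by push_cast; ring, h2]
    simp only [smul_eq_mul, zsmul_eq_mul]
    rw [← h4]
    push_cast
    ring

theorem succ_smul_hasseDeriv_succ (k : ℕ) (f : LaurentSeries ℂ) :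
    ((k : ℂ) + 1) • hasseDeriv ℂ (k + 1) f = hasseDeriv ℂ 1 (hasseDeriv ℂ k f) := by
  rw [hasseDeriv_comp, Nat.choose_one_right, add_comm 1 k, ← Nat.cast_smul_eq_nsmul ℂ]
  simp

theorem hasseDeriv_succ (k : ℕ) (f : LaurentSeries ℂ) :
    hasseDeriv ℂ (k + 1) f = ((k : ℂ) + 1)⁻¹ • hasseDeriv ℂ 1 (hasseDeriv ℂ k f) := by
  rw [← succ_smul_hasseDeriv_succ, inv_smul_smul₀]
  exact_mod_cast Nat.succ_ne_zero k

/-- Each derivative lowers one of the two exponents by one. Only the total drop matters later: in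
`smear_mem_zhuO_of_mem_zhuO` it is matched with the weight of a mode. -/
theorem hasseDeriv_onePlusPow_mem_span (p q : ℤ) (k : ℕ) :
    hasseDeriv ℂ k (onePlusPow p q) ∈
      Submodule.span ℂ {f | ∃ i j : ℕ, i + j = k ∧ f = onePlusPow (p - i) (q - j)} := by
  induction k with
  | zero => exact Submodule.subset_span ⟨0, 0, rfl, by simp⟩
  | succ k ih =>
    rw [hasseDeriv_succ]
    refine Submodule.smul_mem _ _ ?_
    refine Submodule.span_induction (p := fun f _ => hasseDeriv ℂ 1 f ∈ _) ?_ ?_ ?_ ?_ ih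
    · rintro f ⟨i, j, h, rfl⟩
      rw [derivative_onePlusPow]
      refine add_mem (Submodule.smul_mem _ _ (Submodule.subset_span ⟨i + 1, j, by lia, ?_⟩))
        (Submodule.smul_mem _ _ (Submodule.subset_span ⟨i, j + 1, by lia, ?_⟩))
      · congr 1
        push_cast
        ring
      · congr 1
        push_cast
        ring
    · rw [map_zero]
      exact zero_mem _
    · intro f g _ _ hf hg
      rw [map_add]
      exact add_mem hf hg
    · intro c f _ hf
      rw [map_smul]
      exact Submodule.smul_mem _ _ hf

/-- Without a power of z, the product rule leaves a single term. This is why the associator formula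
reproduces (a*b)*c exactly. -/
theorem hasseDeriv_onePlusPow_zero (p : ℤ) (k : ℕ) :
    hasseDeriv ℂ k (onePlusPow p 0) = ((Ring.choose p k : ℤ) : ℂ) • onePlusPow (p - k) 0 := by
  induction k with
  | zero => simp
  | succ k ih =>
    rw [hasseDeriv_succ, ih, map_smul, derivative_onePlusPow, Int.cast_zero]
    rw [zero_smul ℂ (onePlusPow (p - k) (0 - 1)), add_zero, smul_smul, smul_smul]
    have h3 := Ring.choose_smul_choose p (Nat.le_succ k)
    have h4 : ((k : ℂ) + 1) * (Ring.choose p (k + 1) : ℤ) = (Ring.choose p k : ℤ) * (p - k) := by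
      have := congrArg (Int.cast (R := ℂ)) h3
      simpa using this
    have h5 : (k : ℂ) + 1 ≠ 0 := by exact_mod_cast Nat.succ_ne_zero k
    congr 1
    · push_cast
      rw [mul_assoc, ← h4, inv_mul_cancel_left₀ h5]
    · congr 1
      push_cast
      ring

/-- A bilinear map on Laurent series that vanishes on monomials and on series of high order
vanishes. -/
theorem bilinear_eq_zero {V : Type*} [AddCommGroup V] [Module ℂ V]
    (B : LaurentSeries ℂ →ₗ[ℂ] LaurentSeries ℂ →ₗ[ℂ] V) (m n M : ℤ)
    (hmono : ∀ j k, m ≤ j → n ≤ k → B (single j 1) (single k 1) = 0)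
    (hleft : ∀ f g, (∀ j < M, f.coeff j = 0) → (∀ k < n, g.coeff k = 0) → B f g = 0)
    (hright : ∀ f g, (∀ j < m, f.coeff j = 0) → (∀ k < M, g.coeff k = 0) → B f g = 0)
    (f g : LaurentSeries ℂ) (hf : ∀ j < m, f.coeff j = 0) (hg : ∀ k < n, g.coeff k = 0) :
    B f g = 0 := by
  -- Removing the finitely many terms of degree in [m, M) leaves a series of order at least M, where
  -- `hleft` or `hright` applies.
  have key : ∀ (f : LaurentSeries ℂ) (m : ℤ), (∀ j < m, f.coeff j = 0) →
      ∀ j < M, (f - ∑ i ∈ Ico m M, f.coeff i • single i (1 : ℂ)).coeff j = 0 := by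
    intro f m hf j hj
    rw [coeff_sub, coeff_sum]
    simp only [coeff_smul, coeff_single, smul_eq_mul, mul_ite, mul_one, mul_zero, sum_ite_eq,
      mem_Ico, hj, and_true]
    split_ifs with h
    · exact sub_self _
    · rw [hf j (not_le.1 h), sub_zero]
  have key' : ∀ (f : LaurentSeries ℂ) (m : ℤ),
      ∀ j < m, (∑ i ∈ Ico m M, f.coeff i • single i (1 : ℂ)).coeff j = 0 := by
    intro f m j hj
    rw [coeff_sum]
    refine sum_eq_zero fun i hi => ?_
    rw [coeff_smul, coeff_single_of_ne (by simp at hi; lia), smul_zero]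
  have hB : B (∑ i ∈ Ico m M, f.coeff i • single i (1 : ℂ))
      (∑ i ∈ Ico n M, g.coeff i • single i (1 : ℂ)) = 0 := by
    simp only [map_sum, map_smul, LinearMap.sum_apply, LinearMap.smul_apply]
    refine sum_eq_zero fun i hi => ?_
    rw [sum_eq_zero fun j hj => ?_, smul_zero]
    rw [hmono _ _ (mem_Ico.1 hj).1 (mem_Ico.1 hi).1, smul_zero]
  have h1 := hleft _ g (key f m hf) hg
  have h2 := hright _ _ (key' f m) (key g n hg)
  rw [map_sub, LinearMap.sub_apply, sub_eq_zero] at h1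
  rw [map_sub, sub_eq_zero] at h2
  rw [h1, h2, hB]

end LaurentSeries

/-! ### Orders of vanishing and scalar multiplication -/

namespace LaurentSeries

open HahnSeries

theorem coeff_mul_eq_zero_of_lt {f g : LaurentSeries ℂ} {m n k : ℤ} (hf : ∀ j < m, f.coeff j = 0)
    (hg : ∀ j < n, g.coeff j = 0) (hk : k < m + n) : (f * g).coeff k = 0 := by
  rw [coeff_mul]
  refine Finset.sum_eq_zero fun ij hij => ?_
  have h := (Finset.mem_antidiagonal.1 hij).2.2
  by_cases h1 : ij.1 < m
  · rw [hf _ h1, zero_mul]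
  · rw [hg ij.2 (by lia), mul_zero]

theorem coeff_single_mul_eq_zero_of_lt {f : LaurentSeries ℂ} {m r k : ℤ}
    (hf : ∀ j < m, f.coeff j = 0) (hk : k < r + m) :
    ((single r 1 : LaurentSeries ℂ) * f).coeff k = 0 := by
  rw [coeff_single_mul, hf _ (by lia), mul_zero]

theorem coeff_hasseDeriv_eq_zero_of_lt {f : LaurentSeries ℂ} {m k : ℤ} {i : ℕ}
    (hf : ∀ j < m, f.coeff j = 0) (hk : k < m - i) : (hasseDeriv ℂ i f).coeff k = 0 := by
  rw [hasseDeriv_coeff, hf _ (by lia), smul_zero]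

theorem single_eq_smul_single_one (n : ℤ) (c : ℂ) :
    (single n c : LaurentSeries ℂ) = c • single n (1 : ℂ) := by
  ext k
  by_cases h : k = n
  · subst h
    simp
  · simp [coeff_single_of_ne h]

theorem smul_mul_left (c : ℂ) (f g : LaurentSeries ℂ) : (c • f) * g = c • (f * g) :=
  letI : Algebra ℂ (HahnSeries ℤ ℂ) := HahnSeries.instAlgebra
  Algebra.smul_mul_assoc c f g

theorem smul_mul_right (c : ℂ) (f g : LaurentSeries ℂ) : f * (c • g) = c • (f * g) :=
  letI : Algebra ℂ (HahnSeries ℤ ℂ) := HahnSeries.instAlgebra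
  Algebra.mul_smul_comm c f g

end LaurentSeries

/-! ### Residues against Laurent series and the Jacobi identity -/

namespace VertexAlgebra

open HahnSeries LaurentSeries Finset

variable {V : Type*} [AddCommGroup V] [Module ℂ V] (A : VertexAlgebra V)

theorem finite_support_coeff_smul_mode (f : LaurentSeries ℂ) (u v : V) :
    (Function.support fun n : ℤ => f.coeff n • A.mode u n v).Finite := by
  obtain ⟨N, hN⟩ := A.exists_mode_eq_zero u v
  refine (Set.finite_Ico f.order N).subset fun n hn => ?_
  by_contra h
  apply hn
  rw [Set.mem_Ico, not_and_or, not_le, not_lt] at h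
  rcases h with h | h
  · simp [coeff_eq_zero_of_lt_order h]
  · simp [hN n h]

/-- The residue `Res_z f(z) Y(u, z) v` for a Laurent series `f`. -/
noncomputable def smear : LaurentSeries ℂ →ₗ[ℂ] V →ₗ[ℂ] V →ₗ[ℂ] V where
  toFun f := LinearMap.mk₂ ℂ (fun u v => ∑ᶠ n : ℤ, f.coeff n • A.mode u n v)
    (fun u u' v => by
      rw [← finsum_add_distrib (A.finite_support_coeff_smul_mode f u v)
        (A.finite_support_coeff_smul_mode f u' v)]
      simp only [mode_add, smul_add])
    (fun c u v => by
      rw [smul_finsum' c (A.finite_support_coeff_smul_mode f u v)]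
      simp only [mode_smul, smul_comm c])
    (fun u v v' => by
      rw [← finsum_add_distrib (A.finite_support_coeff_smul_mode f u v)
        (A.finite_support_coeff_smul_mode f u v')]
      simp only [map_add, smul_add])
    (fun c u v => by
      rw [smul_finsum' c (A.finite_support_coeff_smul_mode f u v)]
      simp only [map_smul, smul_comm c])
  map_add' f g := by
    ext u v
    simp only [LinearMap.mk₂_apply, LinearMap.add_apply]
    rw [← finsum_add_distrib (A.finite_support_coeff_smul_mode f u v)
      (A.finite_support_coeff_smul_mode g u v)]
    simp only [coeff_add, add_smul]
  map_smul' c f := by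
    ext u v
    simp only [LinearMap.mk₂_apply, LinearMap.smul_apply, RingHom.id_apply]
    rw [smul_finsum' c (A.finite_support_coeff_smul_mode f u v)]
    simp only [coeff_smul, smul_eq_mul, mul_smul]

theorem smear_apply (f : LaurentSeries ℂ) (u v : V) :
    A.smear f u v = ∑ᶠ n : ℤ, f.coeff n • A.mode u n v := rfl

theorem smear_mem (W : Submodule ℂ V) {f : LaurentSeries ℂ} {u v : V}
    (h : ∀ n, f.coeff n ≠ 0 → A.mode u n v ∈ W) : A.smear f u v ∈ W := by
  rw [smear_apply]
  refine finsum_induction (· ∈ W) W.zero_mem (fun _ _ => W.add_mem) fun n => ?_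
  by_cases hn : f.coeff n = 0
  · simp [hn]
  · exact W.smul_mem _ (h n hn)

theorem smear_eq_zero {f : LaurentSeries ℂ} {u v : V} {m : ℤ} (hf : ∀ n < m, f.coeff n = 0)
    (h : ∀ n, m ≤ n → A.mode u n v = 0) : A.smear f u v = 0 := by
  rw [← Submodule.mem_bot ℂ]
  refine A.smear_mem ⊥ fun n hn => ?_
  by_contra h'
  exact hn (hf n (not_le.1 fun hmn => h' (by simp [h n hmn])))

theorem smear_single (n : ℤ) (u v : V) : A.smear (single n 1) u v = A.mode u n v := by
  rw [smear_apply, finsum_eq_single _ n]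
  · simp
  · intro m hm
    rw [coeff_single_of_ne hm, zero_smul]

theorem smear_onePlusPow_eq_sum (p q : ℤ) (u v : V) (N : ℕ)
    (hN : ∀ n, q + N ≤ n → A.mode u n v = 0) :
    A.smear (onePlusPow p q) u v = ∑ i ∈ range N, Ring.choose p i • A.mode u (q + i) v := by
  rw [smear_apply, finsum_eq_sum_of_support_subset (s := (range N).image fun i : ℕ => q + i)]
  · rw [sum_image (by intro i _ j _ h; simpa using h)]
    refine sum_congr rfl fun i _ => ?_
    rw [coeff_onePlusPow_add, Int.cast_smul_eq_zsmul]
  · intro n hn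
    by_contra h
    apply hn
    simp only [coe_image, coe_range, Set.mem_image, Set.mem_Iio, not_exists, not_and] at h
    dsimp only
    rcases lt_or_ge n q with h1 | h1
    · rw [coeff_onePlusPow_of_lt h1, zero_smul]
    · rw [hN n, smul_zero]
      by_contra h2
      exact h (n - q).toNat (by lia) (by lia)

theorem res_eq_smear (a b : ℤ) (u v : V) :
    A.res a b u v = A.smear (onePlusPow a (-b)) u v := by
  obtain ⟨K, hK⟩ := A.exists_mode_eq_zero u v
  rw [A.smear_onePlusPow_eq_sum _ _ _ _ (K + b).toNat fun n hn => hK n (by lia)]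
  change ∑ᶠ i : ℕ, Ring.choose a i • A.mode u (i - b) v = _
  rw [finsum_eq_sum_of_support_subset (s := range (K + b).toNat)]
  · refine sum_congr rfl fun i _ => ?_
    rw [sub_eq_neg_add]
  · intro i hi
    by_contra h
    apply hi
    simp only [coe_range, Set.mem_Iio, not_lt] at h
    simp [hK (i - b) (by lia)]

theorem exists_forall_mode_eq_zero {ι : Type*} (s : Finset ι) (u v : ι → V) :
    ∃ M : ℤ, ∀ i ∈ s, ∀ n, M ≤ n → A.mode (u i) n (v i) = 0 := by
  choose K hK using fun i => A.exists_mode_eq_zero (u i) (v i)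
  obtain ⟨M, hM⟩ := (s.image K).exists_le
  exact ⟨M, fun i hi n hn => hK i n ((hM _ (mem_image_of_mem K hi)).trans hn)⟩

theorem exists_forall_mode_mode_eq_zero (u v w : V) (n : ℤ) :
    ∃ M : ℤ, ∀ j k, M ≤ j → n ≤ k → A.mode u j (A.mode v k w) = 0 := by
  obtain ⟨K, hK⟩ := A.exists_mode_eq_zero v w
  obtain ⟨M, hM⟩ := A.exists_forall_mode_eq_zero (Ico n K) (fun _ => u) fun k => A.mode v k w
  refine ⟨M, fun j k hj hk => ?_⟩
  by_cases h : k < K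
  · exact hM k (mem_Ico.2 ⟨hk, h⟩) j hj
  · rw [hK k (not_lt.1 h), map_zero]

/-- A common cutoff from lower truncation replaces the three `finsum`s by sums over one range, which
are linear without side conditions. -/
theorem jacobi_sum (u v w : V) (l m n : ℤ) (N : ℕ) (hvw : ∀ k, n + N ≤ k → A.mode v k w = 0)
    (huw : ∀ k, m + N ≤ k → A.mode u k w = 0) (huv : ∀ k, l + N ≤ k → A.mode u k v = 0) :
    (∑ i ∈ range N, ((-1 : ℤ) ^ i * Ring.choose l i) •
        A.mode u (m + l - i) (A.mode v (n + i) w))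
      - (∑ i ∈ range N, (((-1 : ℤˣ) ^ l : ℤˣ) * ((-1 : ℤ) ^ i * Ring.choose l i)) •
        A.mode v (n + l - i) (A.mode u (m + i) w))
      = ∑ i ∈ range N, (Ring.choose m i : ℤ) • A.mode (A.mode u (l + i) v) (m + n - i) w := by
  have h := A.jacobi u v w l m n
  rw [finsum_eq_sum_of_support_subset (s := range N), finsum_eq_sum_of_support_subset (s := range N),
    finsum_eq_sum_of_support_subset (s := range N)] at h
  · exact h
  all_goals
    intro i hi
    by_contra h
    apply hi
    simp only [coe_range, Set.mem_Iio, not_lt] at h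
  · have : A.mode u (l + i) v = 0 := huv _ (by lia)
    unfold mode at this
    simp [this]
  · have : A.mode u (m + i) w = 0 := huw _ (by lia)
    unfold mode at this
    simp [this]
  · have : A.mode v (n + i) w = 0 := hvw _ (by lia)
    unfold mode at this
    simp [this]

/-- The residue of the Jacobi identity against `f(x₁) g(x₂)`. -/
theorem jacobi_smear (u v w : V) (l : ℤ) (f g : LaurentSeries ℂ) :
    ∃ N₀ : ℕ, ∀ N, N₀ ≤ N →
    (∑ i ∈ range N, ((-1 : ℤ) ^ i * Ring.choose l i) •
        A.smear (single (l - i) 1 * f) u (A.smear (single (i : ℤ) 1 * g) v w))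
      - (∑ i ∈ range N, (((-1 : ℤˣ) ^ l : ℤˣ) * ((-1 : ℤ) ^ i * Ring.choose l i)) •
        A.smear (single (l - i) 1 * g) v (A.smear (single (i : ℤ) 1 * f) u w))
      = ∑ i ∈ range N, A.smear (hasseDeriv ℂ i f * g) (A.mode u (l + i) v) w := by
  have hf : ∀ j < f.order, f.coeff j = 0 := fun j => coeff_eq_zero_of_lt_order
  have hg : ∀ j < g.order, g.coeff j = 0 := fun j => coeff_eq_zero_of_lt_order
  generalize f.order = m at hf
  generalize g.order = n at hg
  obtain ⟨K₁, huv⟩ := A.exists_mode_eq_zero u v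
  obtain ⟨K₂, huw⟩ := A.exists_mode_eq_zero u w
  obtain ⟨K₃, hvw⟩ := A.exists_mode_eq_zero v w
  obtain ⟨M₁, huvw⟩ := A.exists_forall_mode_mode_eq_zero u v w n
  obtain ⟨M₂, hvuw⟩ := A.exists_forall_mode_mode_eq_zero v u w m
  -- For i ≥ N the vectors u_{l+i}v, u_{m+i}w and v_{n+i}w vanish. The same N serves all monomials
  -- of exponents at least m and n.
  refine ⟨(K₁ - l).toNat + (K₂ - m).toNat + (K₃ - n).toNat, fun N hN => ?_⟩
  obtain ⟨M₃, huv_w⟩ := A.exists_forall_mode_eq_zero (range N) (fun i => A.mode u (l + i) v)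
    fun _ => w
  -- The defect of the identity, bilinear in (f, g): on monomials it vanishes by `jacobi_sum`, in
  -- high order by truncation.
  let B : LaurentSeries ℂ →ₗ[ℂ] LaurentSeries ℂ →ₗ[ℂ] V := LinearMap.mk₂ ℂ (fun f g =>
    (∑ i ∈ range N, ((-1 : ℤ) ^ i * Ring.choose l i) •
        A.smear (single (l - i) 1 * f) u (A.smear (single (i : ℤ) 1 * g) v w))
      - (∑ i ∈ range N, (((-1 : ℤˣ) ^ l : ℤˣ) * ((-1 : ℤ) ^ i * Ring.choose l i)) •
        A.smear (single (l - i) 1 * g) v (A.smear (single (i : ℤ) 1 * f) u w))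
      - ∑ i ∈ range N, A.smear (hasseDeriv ℂ i f * g) (A.mode u (l + i) v) w)
    (fun f f' g => by
      simp only [mul_add, add_mul, map_add, LinearMap.add_apply, smul_add, sum_add_distrib]
      abel)
    (fun c f g => by
      simp only [smul_mul_left, smul_mul_right, map_smul, LinearMap.smul_apply, smul_sub, smul_sum,
        smul_comm c])
    (fun f g g' => by
      simp only [mul_add, map_add, LinearMap.add_apply, smul_add, sum_add_distrib]
      abel)
    (fun c f g => by
      simp only [smul_mul_right, map_smul, LinearMap.smul_apply, smul_sub, smul_sum, smul_comm c])
  have hB : ∀ f g, B f g = (∑ i ∈ range N, ((-1 : ℤ) ^ i * Ring.choose l i) •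
        A.smear (single (l - i) 1 * f) u (A.smear (single (i : ℤ) 1 * g) v w))
      - (∑ i ∈ range N, (((-1 : ℤˣ) ^ l : ℤˣ) * ((-1 : ℤ) ^ i * Ring.choose l i)) •
        A.smear (single (l - i) 1 * g) v (A.smear (single (i : ℤ) 1 * f) u w))
      - ∑ i ∈ range N, A.smear (hasseDeriv ℂ i f * g) (A.mode u (l + i) v) w := fun _ _ => rfl
  rw [← sub_eq_zero, ← hB]
  have hfu : ∀ (x y : V) (j : ℤ) (F : LaurentSeries ℂ) (n : ℤ) (_ : ∀ i < n, F.coeff i = 0)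
      (_ : ∀ k, n ≤ k → A.mode x j (A.mode y k w) = 0), A.mode x j (A.smear F y w) = 0 := by
    intro x y j F n hF h
    refine A.smear_mem (LinearMap.ker (A.mode x j)) fun k hk => ?_
    exact h k (not_lt.1 fun h' => hk (hF k h'))
  -- If either series has order at least M, every term dies. The shifts absorb the factors z^{l-i}
  -- and the order lost to the i-th derivative, i < N.
  obtain ⟨M, hM₁, hM₂, hM₃, hM₄, hM₅, hM₆⟩ : ∃ M : ℤ, M₁ - l + N ≤ M ∧ M₂ - l + N ≤ M ∧
      M₃ + N - n ≤ M ∧ M₃ + N - m ≤ M ∧ K₂ ≤ M ∧ K₃ ≤ M :=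
    ⟨(M₁ - l + N).toNat + (M₂ - l + N).toNat + (M₃ + N - n).toNat + (M₃ + N - m).toNat +
      K₂.toNat + K₃.toNat, by omega⟩
  refine bilinear_eq_zero B m n M ?_ ?_ ?_ f g hf hg
  · intro j k hj hk
    rw [hB]
    rw [sub_eq_zero]
    have := A.jacobi_sum u v w l j k N (fun i hi => hvw i (by omega)) (fun i hi => huw i (by omega))
      (fun i hi => huv i (by omega))
    refine (congrArg₂ (· - ·) (sum_congr rfl fun i _ => ?_) (sum_congr rfl fun i _ => ?_)).trans
      (this.trans (sum_congr rfl fun i _ => ?_))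
    · simp only [single_mul_single, one_mul, smear_single]
      rw [show l - i + j = j + l - i by ring, add_comm (i : ℤ) k]
    · simp only [single_mul_single, one_mul, smear_single]
      rw [show l - i + k = k + l - i by ring, add_comm (i : ℤ) j]
    · rw [hasseDeriv_single, single_mul_single, mul_one, zsmul_one,
        single_eq_smul_single_one, map_smul, LinearMap.smul_apply,
        LinearMap.smul_apply, smear_single, Int.cast_smul_eq_zsmul]
      rw [show j - i + k = j + k - i by ring]
  · intro f g hf hg
    rw [hB, sum_eq_zero, sum_eq_zero, sum_eq_zero, sub_zero, sub_zero]
    all_goals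
      intro i hi
      have hi' := mem_range.1 hi
    · refine A.smear_eq_zero (fun j hj => coeff_mul_eq_zero_of_lt
        (fun _ => coeff_hasseDeriv_eq_zero_of_lt hf) hg hj) fun j hj => huv_w i hi j ?_
      omega
    · rw [A.smear_eq_zero (u := u) (fun j hj => coeff_single_mul_eq_zero_of_lt hf hj)
        fun j hj => huw j (by omega), map_zero, smul_zero]
    · rw [A.smear_eq_zero (u := u) (fun j hj => coeff_single_mul_eq_zero_of_lt hf hj)
        fun j hj => hfu _ _ _ _ _ (fun j hj => coeff_single_mul_eq_zero_of_lt hg hj)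
        fun k hk => huvw j k (by omega) (by omega), smul_zero]
  · intro f g hf hg
    rw [hB, sum_eq_zero, sum_eq_zero, sum_eq_zero, sub_zero, sub_zero]
    all_goals
      intro i hi
      have hi' := mem_range.1 hi
    · refine A.smear_eq_zero (fun j hj => coeff_mul_eq_zero_of_lt
        (fun _ => coeff_hasseDeriv_eq_zero_of_lt hf) hg hj) fun j hj => huv_w i hi j ?_
      omega
    · rw [A.smear_eq_zero (u := v) (fun j hj => coeff_single_mul_eq_zero_of_lt hg hj)
        fun j hj => hfu _ _ _ _ _ (fun j hj => coeff_single_mul_eq_zero_of_lt hf hj)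
        fun k hk => hvuw j k (by omega) (by omega), smul_zero]
    · rw [A.smear_eq_zero (u := v) (fun j hj => coeff_single_mul_eq_zero_of_lt hg hj)
        fun j hj => hvw j (by omega), map_zero, smul_zero]

end VertexAlgebra

/-! ### Commutator, associator, translation and skew symmetry -/

namespace VertexAlgebra

open HahnSeries LaurentSeries Finset

variable {V : Type*} [AddCommGroup V] [Module ℂ V] (A : VertexAlgebra V)

theorem neg_one_pow_mul_choose_neg_one (i : ℕ) : (-1 : ℤ) ^ i * Ring.choose (-1 : ℤ) i = 1 := by
  rw [Ring.choose_neg, add_sub_cancel_left, Ring.choose_natCast, Nat.choose_self]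
  simp [Units.smul_def, Int.negOnePow_def, ← mul_pow]

theorem neg_one_pow_mul_choose_neg_two (i : ℕ) :
    (-1 : ℤ) ^ i * Ring.choose (-2 : ℤ) i = i + 1 := by
  rw [Ring.choose_neg, show (2 : ℤ) + i - 1 = ((i + 1 : ℕ) : ℤ) by push_cast; ring,
    Ring.choose_natCast, Nat.choose_succ_self_right]
  have h : (-1 : ℤ) ^ i * (-1) ^ i = 1 := by simp [← mul_pow]
  simp only [Units.smul_def, Int.negOnePow_def, zpow_natCast, Units.val_pow_eq_pow_val,
    Units.val_neg, Units.val_one, smul_eq_mul, Nat.cast_add, Nat.cast_one]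
  linear_combination ((i : ℤ) + 1) * h

/-- The commutator formula. -/
theorem smear_commutator (u v w : V) (f g : LaurentSeries ℂ) :
    ∃ N : ℕ, A.smear f u (A.smear g v w) - A.smear g v (A.smear f u w) =
      ∑ i ∈ range N, A.smear (hasseDeriv ℂ i f * g) (A.mode u i v) w := by
  obtain ⟨N, hN⟩ := A.jacobi_smear u v w 0 f g
  refine ⟨N + 1, ?_⟩
  have h := hN (N + 1) (Nat.le_succ N)
  rw [sum_range_succ' (fun i => ((-1 : ℤ) ^ i * Ring.choose 0 i) • _),
    sum_range_succ' (fun i => (((-1 : ℤˣ) ^ (0 : ℤ) : ℤˣ) * ((-1 : ℤ) ^ i * Ring.choose 0 i)) • _)]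
    at h
  simpa using h

/-- The associator formula. -/
theorem smear_iterate (u v w : V) (f g : LaurentSeries ℂ) :
    ∃ N₀ : ℕ, ∀ N, N₀ ≤ N →
      ∑ i ∈ range N, A.smear (single (-1 - i : ℤ) 1 * f) u (A.smear (single (i : ℤ) 1 * g) v w)
      + ∑ i ∈ range N, A.smear (single (-1 - i : ℤ) 1 * g) v (A.smear (single (i : ℤ) 1 * f) u w)
      = ∑ i ∈ range N, A.smear (hasseDeriv ℂ i f * g) (A.mode u (-1 + i) v) w := by
  obtain ⟨N, hN⟩ := A.jacobi_smear u v w (-1) f g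
  refine ⟨N, fun M hM => ?_⟩
  have h := hN M hM
  simpa [neg_one_pow_mul_choose_neg_one] using h

/-- The translation operator `v ↦ v₋₂𝟏`. -/
noncomputable def deriv (u : V) : V := A.mode u (-2) A.vac

theorem mode_zero_left (n : ℤ) (w : V) : A.mode 0 n w = 0 := by simp [mode]

theorem mode_vac (n : ℤ) (w : V) : A.mode A.vac n w = if n = -1 then w else 0 := A.vacuum n w

/-- Jacobi identity with v = 𝟏, l = -2, m = 0: the right side keeps only i = 0, and on the left Y(𝟏,
x) = id selects one mode, from the first sum if n < 0, from the second if n > 0, and none if n = 0.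
-/
theorem mode_deriv (u w : V) (n : ℤ) :
    A.mode (A.deriv u) n w = -(n : ℂ) • A.mode u (n - 1) w := by
  obtain ⟨K, hK⟩ := A.exists_mode_eq_zero u w
  obtain ⟨N, hN₁, hN₂, hN₃⟩ : ∃ N : ℕ, K ≤ N ∧ -n + 1 ≤ N ∧ n + 1 ≤ N :=
    ⟨K.toNat + (-n + 1).toNat + (n + 1).toNat, by omega⟩
  have h := A.jacobi_sum u A.vac w (-2) 0 n (N + 2) (fun k hk => by
    rw [mode_vac, if_neg (by push_cast at hk; omega)])
    (fun k hk => hK k (by push_cast at hk; omega))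
    (fun k hk => A.creation_nonneg u k (by push_cast at hk; omega))
  rw [sum_range_succ' (fun i => Ring.choose (0 : ℤ) i • _)] at h
  simp only [neg_one_pow_mul_choose_neg_two, mode_vac, Ring.choose_zero_succ, zero_smul,
    sum_const_zero, zero_add, Ring.choose_zero_right, one_smul, Nat.cast_zero, add_zero,
    sub_zero] at h
  rw [deriv, ← h]
  rcases lt_trichotomy n 0 with hn | hn | hn
  · rw [sum_eq_single (-1 - n).toNat, sum_eq_zero, sub_zero, if_pos (by omega)]
    · rw [show ((-1 - n).toNat : ℤ) = -1 - n by omega, ← Int.cast_smul_eq_zsmul ℂ]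
      rw [show (-2 : ℤ) - (-1 - n) = n - 1 by ring]
      congr 1
      push_cast
      ring
    · intro i _
      rw [if_neg (by omega), smul_zero]
    · intro i _ hi
      rw [if_neg (by omega), map_zero, smul_zero]
    · intro hi
      exact absurd (mem_range.2 (by omega)) hi
  · subst hn
    rw [sum_eq_zero, sum_eq_zero]
    · simp
    · intro i _
      rw [if_neg (by omega), smul_zero]
    · intro i _
      rw [if_neg (by omega), map_zero, smul_zero]
  · rw [sum_eq_zero, sum_eq_single (n - 1).toNat, zero_sub, if_pos (by omega)]
    · rw [show ((n - 1).toNat : ℤ) = n - 1 by omega, ← Int.cast_smul_eq_zsmul ℂ]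
      simp
    · intro i _ hi
      rw [if_neg (by omega), smul_zero]
    · intro hi
      exact absurd (mem_range.2 (by omega)) hi
    · intro i _
      rw [if_neg (by omega), map_zero, smul_zero]

/-- Integration by parts: `mode_deriv` says that the derivative of u acts as d/dz on Y(u, z). -/
theorem smear_deriv (f : LaurentSeries ℂ) (u w : V) :
    A.smear f (A.deriv u) w = -A.smear (hasseDeriv ℂ 1 f) u w := by
  rw [smear_apply, smear_apply, ← finsum_neg_distrib,
    ← finsum_comp_equiv (Equiv.addRight (1 : ℤ))]
  refine finsum_congr fun n => ?_
  rw [mode_deriv, hasseDeriv_coeff]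
  simp only [Equiv.coe_addRight, add_sub_cancel_right, Nat.cast_one, Ring.choose_one_right,
    smul_smul, zsmul_eq_mul, ← neg_smul]
  congr 1
  ring

/-- Skew symmetry. -/
theorem mode_skew (u v : V) (l : ℤ) (N : ℕ) (hN : ∀ k, l + N ≤ k → A.mode u k v = 0) :
    A.mode v l u = ∑ i ∈ range N,
      (((-1 : ℤˣ) ^ (l + 1 + i) : ℤˣ) : ℤ) • A.mode (A.mode u (l + i) v) (-1 - i) A.vac := by
  -- With w = 𝟏, m = -1, n = 0 the creation axiom kills the first sum and leaves only i = 0 in the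
  -- second, where u_{-1}𝟏 = u.
  have h := A.jacobi_sum u v A.vac l (-1) 0 (N + 1)
    (fun k hk => A.creation_nonneg v k (by push_cast at hk; omega))
    (fun k hk => A.creation_nonneg u k (by push_cast at hk; omega))
    (fun k hk => hN k (by push_cast at hk; omega))
  rw [sum_eq_zero (fun i _ => by rw [show A.mode v (0 + i) A.vac = 0 from
      A.creation_nonneg _ _ (by omega), map_zero, smul_zero]),
    sum_range_succ' (fun i => (((-1 : ℤˣ) ^ l : ℤˣ) * ((-1 : ℤ) ^ i * Ring.choose l i)) • _),
    sum_eq_zero (fun i _ => by rw [show A.mode u (-1 + (i + 1 : ℕ)) A.vac = 0 from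
      A.creation_nonneg _ _ (by push_cast; omega), map_zero, smul_zero]),
    sum_range_succ, hN (l + N) le_rfl] at h
  simp only [pow_zero, Ring.choose_zero_right, Nat.cast_zero, add_zero, sub_zero, zero_add,
    mul_one] at h
  rw [show A.mode u (-1) A.vac = u from A.creation_neg_one u] at h
  have h2 : ∀ i : ℕ, Ring.choose (-1 : ℤ) i = (-1) ^ i := by
    intro i
    have := congrArg ((-1 : ℤ) ^ i * ·) (neg_one_pow_mul_choose_neg_one i)
    simpa [← mul_assoc, ← mul_pow] using this
  have h3 : (((-1 : ℤˣ) ^ l : ℤˣ) : ℤ) * (((-1 : ℤˣ) ^ l : ℤˣ) : ℤ) = 1 := by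
    rw [← Units.val_mul, ← mul_zpow]
    simp
  have h4 : A.mode v l u = (((-1 : ℤˣ) ^ l : ℤˣ) : ℤ) • ((((-1 : ℤˣ) ^ l : ℤˣ) : ℤ) •
      A.mode v l u) := by
    rw [smul_smul, h3, one_smul]
  rw [h4, ← neg_neg ((((-1 : ℤˣ) ^ l : ℤˣ) : ℤ) • A.mode v l u), ← zero_sub (_ • _), h,
    mode_zero_left, smul_zero, add_zero, smul_neg, smul_sum, ← sum_neg_distrib]
  refine sum_congr rfl fun i _ => ?_
  rw [h2, smul_smul, ← neg_smul]
  congr 1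
  simp [zpow_add]

end VertexAlgebra

/-! ### Elements of O(V) and its stability under residues -/

namespace CGradedVertexAlgebra

open HahnSeries LaurentSeries Finset VertexAlgebra

variable {V : Type*} [AddCommGroup V] [Module ℂ V] (A : CGradedVertexAlgebra V)

theorem homogeneous_induction {P : V → Prop} (v : V) (hom : ∀ lam, ∀ v ∈ A.wt lam, P v)
    (zero : P 0) (add : ∀ v w, P v → P w → P (v + w)) : P v := by
  refine Submodule.iSup_induction A.wt (motive := P) ?_ hom zero add
  rw [A.isInternal.submodule_iSup_eq_top]
  trivial

theorem extend_of_mem (f : ℂ → V →ₗ[ℂ] V →ₗ[ℂ] V) {lam : ℂ} {u : V} (hu : u ∈ A.wt lam) :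
    A.extend f u = f lam u := by
  have h : (LinearEquiv.ofBijective (DirectSum.coeLinearMap A.wt) A.isInternal).symm u =
      DirectSum.lof ℂ ℂ (fun lam => A.wt lam) lam ⟨u, hu⟩ := by
    rw [LinearEquiv.symm_apply_eq]
    exact (DirectSum.coeLinearMap_lof A.wt lam ⟨u, hu⟩).symm
  rw [extend, LinearMap.comp_apply, LinearEquiv.coe_coe, h, DirectSum.toModule_lof]
  rfl

theorem delta_intCast (n : ℤ) : delta n = 1 := by
  simp [delta]

theorem delta_of_forall_ne {lam : ℂ} (h : ∀ n : ℤ, lam ≠ n) : delta lam = 0 := by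
  rw [delta, if_neg]
  exact fun h' => h _ (sub_eq_zero.1 h')

theorem ceil_re_add_intCast (lam : ℂ) (n : ℤ) : ⌈(lam + n).re⌉ = ⌈lam.re⌉ + n := by
  simp

theorem delta_add_intCast (lam : ℂ) (n : ℤ) : delta (lam + n) = delta lam := by
  simp [delta]

theorem delta_nonneg (lam : ℂ) : 0 ≤ delta lam := by
  rw [delta]
  split_ifs <;> simp

theorem circ_of_mem {lam : ℂ} {u : V} (hu : u ∈ A.wt lam) (v : V) :
    A.circ u v = A.smear (onePlusPow (⌈lam.re⌉ + delta lam - 1) (-(1 + delta lam))) u v := by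
  rw [circ, A.extend_of_mem _ hu, res_eq_smear]

theorem star_of_mem_intCast {n : ℤ} {u : V} (hu : u ∈ A.wt n) (v : V) :
    A.star u v = A.smear (onePlusPow n (-1)) u v := by
  rw [star, A.extend_of_mem _ hu, delta_intCast, one_smul, res_eq_smear]
  simp

theorem star_of_forall_ne {lam : ℂ} (h : ∀ n : ℤ, lam ≠ n) {u : V} (hu : u ∈ A.wt lam) :
    A.star u = 0 := by
  rw [star, A.extend_of_mem _ hu, delta_of_forall_ne h, zero_smul]
  rfl

theorem circ_mem_zhuO (u v : V) : A.circ u v ∈ A.zhuO := Submodule.subset_span ⟨u, v, rfl⟩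

theorem deriv_mem_wt {lam : ℂ} {u : V} (hu : u ∈ A.wt lam) :
    A.deriv u ∈ A.wt (lam + (1 : ℤ)) := by
  have h := A.mode_mem _ _ (-2) _ _ hu A.vac_mem
  rw [VertexAlgebra.deriv]
  convert h using 2
  push_cast
  ring

/-- Applying the previous case to the derivative of u, whose weight is one higher, and integrating
by parts yields the next pole order with coefficient q, the current exponent of z. It can be divided
out because q < 0. -/
theorem smear_onePlusPow_sub_mem_zhuO (n : ℕ) {lam : ℂ} {u : V} (hu : u ∈ A.wt lam) (v : V) :
    A.smear (onePlusPow (⌈lam.re⌉ + delta lam - 1) (-(1 + delta lam) - n)) u v ∈ A.zhuO := by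
  induction n generalizing lam u with
  | zero =>
    rw [Nat.cast_zero, sub_zero, ← A.circ_of_mem hu]
    exact A.circ_mem_zhuO u v
  | succ n ih =>
    have h₁ := ih hu
    have h₂ := ih (A.deriv_mem_wt hu)
    have hδ := delta_nonneg lam
    rw [ceil_re_add_intCast, delta_add_intCast, smear_deriv, derivative_onePlusPow] at h₂
    generalize hq : -(1 + delta lam) - (n : ℤ) = q at h₁ h₂
    generalize hp : ⌈lam.re⌉ + delta lam - 1 = p at h₁ ⊢
    rw [show ⌈lam.re⌉ + 1 + delta lam - 1 - 1 = p by rw [← hp]; ring,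
      show ⌈lam.re⌉ + 1 + delta lam - 1 = p + 1 by rw [← hp]; ring, onePlusPow_succ p (q - 1),
      sub_add_cancel] at h₂
    rw [show -(1 + delta lam) - ((n + 1 : ℕ) : ℤ) = q - 1 by rw [← hq]; push_cast; ring]
    have hq' : (q : ℂ) ≠ 0 := by
      rw [Int.cast_ne_zero]
      omega
    have key : A.smear (onePlusPow p (q - 1)) u v = (q : ℂ)⁻¹ •
        (-(-A.smear (((p + 1 : ℤ) : ℂ) • onePlusPow p q +
            (q : ℂ) • (onePlusPow p (q - 1) + onePlusPow p q)) u v) -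
          ((p : ℂ) + 1 + q) • A.smear (onePlusPow p q) u v) := by
      rw [eq_inv_smul_iff₀ hq']
      simp only [map_add, map_smul, LinearMap.add_apply, LinearMap.smul_apply]
      push_cast
      module
    rw [key]
    exact Submodule.smul_mem _ _ (sub_mem (neg_mem h₂) (Submodule.smul_mem _ _ h₁))

/-- A further factor 1 + z splits a residue into two, one of them with pole order one less; so m
factors are affordable as long as m ≤ n. -/
theorem smear_onePlusPow_mem_zhuO {m n : ℕ} (hmn : m ≤ n) {lam : ℂ} {u : V} (hu : u ∈ A.wt lam)
    (v : V) :
    A.smear (onePlusPow (⌈lam.re⌉ + delta lam - 1 + m) (-(1 + delta lam) - n)) u v ∈ A.zhuO := by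
  induction m generalizing n with
  | zero => simpa using A.smear_onePlusPow_sub_mem_zhuO n hu v
  | succ m ih =>
    obtain ⟨n, rfl⟩ : ∃ k, n = k + 1 := ⟨n - 1, by omega⟩
    have h₁ := ih (n := n + 1) (by omega)
    have h₂ := ih (n := n) (by omega)
    rw [Nat.cast_succ m, ← add_assoc, onePlusPow_succ, map_add, LinearMap.add_apply,
      LinearMap.add_apply]
    refine add_mem h₁ ?_
    convert h₂ using 5
    push_cast
    ring

theorem smear_intCast_mem_zhuO {k : ℤ} {u : V} (hu : u ∈ A.wt k) (n : ℕ) (v : V) :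
    A.smear (onePlusPow k (-2 - n)) u v ∈ A.zhuO := by
  have h := A.smear_onePlusPow_sub_mem_zhuO n hu v
  rw [delta_intCast] at h
  simpa using h

/-- Here δ = 0, so the kernel of ∘ has only a simple pole, and u ∘ 𝟏 = u_{-1}𝟏 = u. -/
theorem wt_le_zhuO {lam : ℂ} (h : ∀ n : ℤ, lam ≠ n) : A.wt lam ≤ A.zhuO := by
  intro u hu
  have h₁ := A.circ_mem_zhuO u A.vac
  rw [A.circ_of_mem hu, delta_of_forall_ne h, A.smear_onePlusPow_eq_sum _ _ _ _ 1
    fun n hn => A.creation_nonneg u n (by simpa using hn)] at h₁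
  have h₂ : A.mode u (-1) A.vac = u := A.creation_neg_one u
  simpa [h₂] using h₁

/-- Moving the residue of c past a ∘ b leaves an element a ∘ b' and commutator terms in the modes
c_i a. The case m = 1 is left multiplication by c; m = 0 is the correction term of
`cls_star_sub_star`. -/
theorem smear_mem_zhuO_of_mem_zhuO {k : ℤ} {c : V} (hc : c ∈ A.wt k) (m : ℕ) {x : V}
    (hx : x ∈ A.zhuO) : A.smear (onePlusPow (k - 1 + m) (-m)) c x ∈ A.zhuO := by
  revert x
  change A.zhuO ≤ A.zhuO.comap (A.smear (onePlusPow (k - 1 + m) (-m)) c)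
  rw [zhuO, Submodule.span_le]
  rintro _ ⟨a, b, rfl⟩
  change A.smear (onePlusPow (k - 1 + m) (-m)) c (A.circ a b) ∈ A.zhuO
  induction a using A.homogeneous_induction with
  | zero => simp
  | add a a' h h' =>
    rw [map_add, LinearMap.add_apply, map_add]
    exact add_mem h h'
  | hom lam a ha =>
    rw [A.circ_of_mem ha]
    obtain ⟨N, hN⟩ := A.smear_commutator c a b (onePlusPow (k - 1 + m) (-m))
      (onePlusPow (⌈lam.re⌉ + delta lam - 1) (-(1 + delta lam)))
    rw [sub_eq_iff_eq_add'] at hN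
    rw [hN, ← A.circ_of_mem ha]
    refine add_mem (A.circ_mem_zhuO _ _) (sum_mem fun i _ => ?_)
    have hmem := hasseDeriv_onePlusPow_mem_span (k - 1 + m) (-m) i
    refine Submodule.span_induction (p := fun f _ => A.smear (f * _) _ _ ∈ _) ?_ ?_ ?_ ?_ hmem
    · rintro _ ⟨i₁, j, hij, rfl⟩
      rw [onePlusPow_mul]
      have hca : A.mode c i a ∈ A.wt (lam + (k - i - 1 : ℤ)) := by
        convert A.mode_mem _ _ i _ _ hc ha using 2
        push_cast
        ring
      -- Measured against the weight of c_i a, both the power of 1 + z and the pole order exceed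
      -- those of ∘ by exactly m + j, the borderline case.
      have := A.smear_onePlusPow_mem_zhuO (le_refl (m + j)) hca b
      rw [ceil_re_add_intCast, delta_add_intCast] at this
      convert this using 4
      · congr 1
        · subst hij
          push_cast
          ring
        · push_cast
          ring
    · simp
    · intro f g _ _ hf hg
      rw [add_mul, map_add]
      exact add_mem hf hg
    · intro c f _ hf
      rw [smul_mul_left, map_smul]
      exact Submodule.smul_mem _ _ hf

end CGradedVertexAlgebra

/-! ### Skew symmetry, two-sided stability and associativity modulo O(V) -/

namespace CGradedVertexAlgebra

open HahnSeries LaurentSeries Finset VertexAlgebra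

variable {V : Type*} [AddCommGroup V] [Module ℂ V] (A : CGradedVertexAlgebra V)

theorem cls_eq_cls {u v : V} : A.cls u = A.cls v ↔ u - v ∈ A.zhuO := Submodule.Quotient.eq _

theorem cls_smul (c : ℂ) (u : V) : A.cls (c • u) = c • A.cls u := map_smul _ c u

theorem cls_zsmul (c : ℤ) (u : V) : A.cls (c • u) = c • A.cls u := map_zsmul _ c u

theorem cls_sum {ι : Type*} (s : Finset ι) (f : ι → V) :
    A.cls (∑ i ∈ s, f i) = ∑ i ∈ s, A.cls (f i) := map_sum _ f s

/-- The residue of (1+z)^k z^{-2} Y(x, z)𝟏 lies in O(V) and equals x_{-2}𝟏 + k x. -/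
theorem cls_deriv {k : ℤ} {x : V} (hx : x ∈ A.wt k) : A.cls (A.deriv x) = -(k : ℂ) • A.cls x := by
  have h := A.smear_intCast_mem_zhuO hx 0 A.vac
  rw [A.smear_onePlusPow_eq_sum _ _ _ _ 2 fun n hn => A.creation_nonneg x n (by simpa using hn),
    sum_range_succ, sum_range_one] at h
  have h₂ : A.mode x (-1) A.vac = x := A.creation_neg_one x
  have h₃ : A.deriv x - -(k : ℂ) • x ∈ A.zhuO := by
    simpa [h₂, VertexAlgebra.deriv, Int.cast_smul_eq_zsmul] using h
  rw [← cls_smul]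
  exact A.cls_eq_cls.2 h₃

/-- Modulo `O(V)`, the divided powers of the translation operator act on `V_k` by binomial
coefficients. -/
theorem cls_mode_vac (i : ℕ) {k : ℤ} {x : V} (hx : x ∈ A.wt k) :
    A.cls (A.mode x (-1 - i) A.vac) = Ring.choose (-k) i • A.cls x := by
  induction i generalizing k x with
  | zero =>
    have h₂ : A.mode x (-1) A.vac = x := A.creation_neg_one x
    simp [h₂]
  | succ i ih =>
    -- The induction passes to the derivative of x, whose mode -1-i is (i+1) x_{-2-i}.
    have hD : A.deriv x ∈ A.wt ((k + 1 : ℤ) : ℂ) := by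
      simpa using A.deriv_mem_wt hx
    have h := ih hD
    have hi : (i : ℂ) + 1 ≠ 0 := by exact_mod_cast Nat.succ_ne_zero i
    rw [A.cls_deriv hx, mode_deriv, cls_smul, ← Int.cast_smul_eq_zsmul ℂ, smul_smul] at h
    have hc : ((i : ℂ) + 1) * (Ring.choose (-k) (i + 1) : ℤ) =
        (Ring.choose (-(k + 1)) i : ℤ) * (-k : ℂ) := by
      have h3 := Ring.choose_smul_choose (-k) (Nat.le_add_left 1 i)
      rw [Nat.choose_one_right, Ring.choose_one_right] at h3
      have := congrArg (Int.cast (R := ℂ)) h3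
      rw [show -k - ((1 : ℕ) : ℤ) = -(k + 1) by push_cast; ring, Nat.add_sub_cancel] at this
      simpa [mul_comm] using this
    rw [← hc] at h
    have h' := congrArg (((i : ℂ) + 1)⁻¹ • ·) h
    rw [smul_smul, smul_smul, inv_mul_cancel_left₀ hi,
      show -(((-1 - i : ℤ)) : ℂ) = (i : ℂ) + 1 by push_cast; ring, inv_mul_cancel₀ hi,
      one_smul, Int.cast_smul_eq_zsmul] at h'
    rw [← h', show -1 - ((i + 1 : ℕ) : ℤ) = -1 - i - 1 by push_cast; ring]

/-- Vandermonde's identity, the upper indices adding up to k - t, followed by negation of the upper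
index. -/
theorem sum_antidiagonal_choose (s t : ℤ) (k : ℕ) :
    ∑ ij ∈ antidiagonal k, Ring.choose s ij.1 * Ring.choose (k - s - t) ij.2 =
      (-1) ^ k * Ring.choose (t - 1) k := by
  rw [← Ring.add_choose_eq k (Commute.all _ _), show s + (k - s - t) = -(t - k) by ring,
    Ring.choose_neg, show t - k + k - 1 = t - 1 by ring]
  simp [Units.smul_def, Int.negOnePow_def]

/-- Skew symmetry for the product `*` modulo `O(V)`. -/
theorem cls_star_eq {s t : ℤ} {u v : V} (hu : u ∈ A.wt s) (hv : v ∈ A.wt t) :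
    A.cls (A.star u v) = A.cls (A.smear (onePlusPow (t - 1) (-1)) v u) := by
  obtain ⟨K₁, hK₁⟩ := A.exists_mode_eq_zero u v
  obtain ⟨K₂, hK₂⟩ := A.exists_mode_eq_zero v u
  obtain ⟨N, hN₁, hN₂⟩ : ∃ N : ℕ, K₁ + 1 ≤ N ∧ K₂ + 1 ≤ N :=
    ⟨(K₁ + 1).toNat + (K₂ + 1).toNat, by omega⟩
  rw [A.star_of_mem_intCast hu, A.smear_onePlusPow_eq_sum _ _ _ _ N fun n hn => hK₁ n (by omega),
    A.smear_onePlusPow_eq_sum _ _ _ _ N fun n hn => hK₂ n (by omega), cls_sum, cls_sum]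
  have key : ∀ i ∈ range N, A.cls (Ring.choose s i • A.mode u (-1 + i) v) =
      ∑ j ∈ range (N - i), (Ring.choose s i * Ring.choose (((i + j : ℕ) : ℤ) - s - t) j *
        (-1) ^ (i + j)) • A.cls (A.mode v (-1 + ((i + j : ℕ) : ℤ)) u) := by
    intro i hi
    rw [mem_range] at hi
    rw [A.mode_skew v u (-1 + i) (N - i) fun k hk => hK₂ k (by omega), cls_zsmul, cls_sum, smul_sum]
    refine sum_congr rfl fun j _ => ?_
    have hw : A.mode v (-1 + i + j) u ∈ A.wt ((s + t - i - j : ℤ) : ℂ) := by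
      convert A.mode_mem _ _ (-1 + i + j) _ _ hv hu using 2
      push_cast
      ring
    rw [cls_zsmul, A.cls_mode_vac j hw, smul_smul, smul_smul]
    congr 1
    · rw [show -1 + (i : ℤ) + 1 + j = ((i + j : ℕ) : ℤ) by push_cast; ring, zpow_natCast,
        show -(s + t - i - j) = ((i + j : ℕ) : ℤ) - s - t by push_cast; ring]
      push_cast
      ring
    · rw [Nat.cast_add, add_assoc]
  -- Collect the terms with i + j = k: all involve v_{k-1}u, of weight s + t - k, so its coefficient
  -- is the Vandermonde sum.
  rw [sum_congr rfl key, ← sum_range_diag_flip N fun i j => (Ring.choose s i *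
    Ring.choose (((i + j : ℕ) : ℤ) - s - t) j * (-1) ^ (i + j)) •
      A.cls (A.mode v (-1 + ((i + j : ℕ) : ℤ)) u)]
  refine sum_congr rfl fun k _ => ?_
  have h2 : (-1 : ℤ) ^ k * (-1) ^ k = 1 := by simp [← mul_pow]
  rw [cls_zsmul, show Ring.choose (t - 1) k = (∑ ij ∈ antidiagonal k,
      Ring.choose s ij.1 * Ring.choose (k - s - t) ij.2) * (-1) ^ k by
    rw [sum_antidiagonal_choose, mul_right_comm, h2, one_mul],
    Nat.sum_antidiagonal_eq_sum_range_succ fun i j => Ring.choose s i * Ring.choose (k - s - t) j,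
    sum_mul, sum_smul]
  refine sum_congr rfl fun i hi => ?_
  rw [mem_range] at hi
  rw [show i + (k - i) = k by omega]

theorem cls_star_sub_star {s t : ℤ} {u v : V} (hu : u ∈ A.wt s) (hv : v ∈ A.wt t) :
    A.cls (A.star u v) = A.cls (A.star v u - A.smear (onePlusPow (t - 1) 0) v u) := by
  rw [A.cls_star_eq hu hv, A.star_of_mem_intCast hv]
  have h := onePlusPow_succ (t - 1) (-1)
  rw [sub_add_cancel, neg_add_cancel] at h
  rw [h, map_add, LinearMap.add_apply, LinearMap.add_apply, add_sub_cancel_right]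

theorem star_mem_zhuO_right (u : V) {x : V} (hx : x ∈ A.zhuO) : A.star u x ∈ A.zhuO := by
  induction u using A.homogeneous_induction with
  | zero => simp
  | add u u' h h' =>
    rw [map_add, LinearMap.add_apply]
    exact add_mem h h'
  | hom lam u hu =>
    by_cases hl : ∀ n : ℤ, lam ≠ n
    · rw [A.star_of_forall_ne hl hu]
      simp
    · push Not at hl
      obtain ⟨n, rfl⟩ := hl
      rw [A.star_of_mem_intCast hu]
      simpa using A.smear_mem_zhuO_of_mem_zhuO hu 1 hx

theorem star_mem_zhuO_of_forall_ne {mu : ℂ} (h : ∀ n : ℤ, mu ≠ n) (x : V) {v : V}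
    (hv : v ∈ A.wt mu) : A.star x v ∈ A.zhuO :=
  A.star_mem_zhuO_right x (A.wt_le_zhuO h hv)

/-- Skew symmetry brings v to the left, where O(V) is already known to be stable. It requires
integral weights, so the non-integral cases are split off. -/
theorem star_mem_zhuO_left {x : V} (hx : x ∈ A.zhuO) (v : V) : A.star x v ∈ A.zhuO := by
  induction v using A.homogeneous_induction with
  | zero => simp
  | add v v' h h' =>
    rw [map_add]
    exact add_mem h h'
  | hom mu v hv =>
    by_cases hm : ∀ n : ℤ, mu ≠ n
    · exact A.star_mem_zhuO_of_forall_ne hm x hv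
    push Not at hm
    obtain ⟨t, rfl⟩ := hm
    revert x
    change A.zhuO ≤ A.zhuO.comap (A.star.flip v)
    rw [zhuO, Submodule.span_le]
    rintro _ ⟨a, b, rfl⟩
    change A.star (A.circ a b) v ∈ A.zhuO
    induction a using A.homogeneous_induction with
    | zero => simp
    | add a a' h h' =>
      rw [map_add, LinearMap.add_apply, map_add, LinearMap.add_apply]
      exact add_mem h h'
    | hom al a ha =>
      induction b using A.homogeneous_induction with
      | zero => simp
      | add b b' h h' =>
        rw [map_add, map_add, LinearMap.add_apply]
        exact add_mem h h'
      | hom be b hb =>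
        have hO := A.circ_mem_zhuO a b
        by_cases hab : ∀ n : ℤ, al + be ≠ n
        · have h0 : A.circ a b ∈ LinearMap.ker (A.star.flip v) := by
            rw [A.circ_of_mem ha]
            refine A.smear_mem _ fun n _ => ?_
            rw [LinearMap.mem_ker, LinearMap.flip_apply, A.star_of_forall_ne (fun k hk => hab
              (k + n + 1) ?_) (A.mode_mem _ _ n _ _ ha hb)]
            · rfl
            · push_cast
              linear_combination hk
          rw [LinearMap.mem_ker, LinearMap.flip_apply] at h0
          rw [h0]
          exact zero_mem _
        · push Not at hab
          obtain ⟨K, hK⟩ := hab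
          have hint : A.circ a b ∈ ⨆ n : ℤ, A.wt n := by
            rw [A.circ_of_mem ha]
            refine A.smear_mem _ fun n _ => Submodule.mem_iSup_of_mem (K - n - 1) ?_
            convert A.mode_mem _ _ n _ _ ha hb using 2
            push_cast
            linear_combination -hK
          have hcomm : ∀ x ∈ ⨆ n : ℤ, A.wt n,
              A.cls (A.star x v) = A.cls (A.star v x - A.smear (onePlusPow (t - 1) 0) v x) := by
            intro x hx
            refine Submodule.iSup_induction _ (motive := fun x => A.cls (A.star x v) =
              A.cls (A.star v x - A.smear (onePlusPow (t - 1) 0) v x)) hx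
              (fun s x hx => A.cls_star_sub_star hx hv) (by simp) fun x y hx hy => ?_
            simp only [cls, map_add, map_sub, LinearMap.add_apply] at hx hy ⊢
            rw [hx, hy]
            abel
          rw [← Submodule.Quotient.mk_eq_zero]
          refine (hcomm _ hint).trans ((Submodule.Quotient.mk_eq_zero _).2 ?_)
          refine sub_mem (A.star_mem_zhuO_right v hO) ?_
          simpa using A.smear_mem_zhuO_of_mem_zhuO hv 0 hO

theorem cls_star_assoc {s t : ℤ} {a b : V} (ha : a ∈ A.wt s) (hb : b ∈ A.wt t) (c : V) :
    A.cls (A.star (A.star a b) c) = A.cls (A.star a (A.star b c)) := by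
  obtain ⟨K, hK⟩ := A.exists_mode_eq_zero a b
  obtain ⟨N₀, hN₀⟩ := A.smear_iterate a b c (onePlusPow s 0) (onePlusPow t (-1))
  obtain ⟨N, hN₁, hN₂⟩ : ∃ N : ℕ, K + 1 ≤ N + 1 ∧ N₀ ≤ N + 1 := ⟨K.toNat + N₀, by omega⟩
  have h := hN₀ (N + 1) hN₂
  have hR : ∑ i ∈ range (N + 1), A.smear (hasseDeriv ℂ i (onePlusPow s 0) * onePlusPow t (-1))
      (A.mode a (-1 + i) b) c = A.star (A.star a b) c := by
    rw [A.star_of_mem_intCast ha, A.smear_onePlusPow_eq_sum _ _ _ _ (N + 1) fun n hn => hK n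
      (by push_cast at hn; omega), map_sum, LinearMap.sum_apply]
    refine sum_congr rfl fun i _ => ?_
    have hw : A.mode a (-1 + i) b ∈ A.wt ((s - i + t : ℤ) : ℂ) := by
      convert A.mode_mem _ _ (-1 + i) _ _ ha hb using 2
      push_cast
      ring
    rw [map_zsmul, LinearMap.smul_apply, A.star_of_mem_intCast hw, hasseDeriv_onePlusPow_zero,
      smul_mul_left, onePlusPow_mul, map_smul, LinearMap.smul_apply, LinearMap.smul_apply,
      Int.cast_smul_eq_zsmul, zero_add]
  rw [hR, sum_range_succ'] at h
  rw [← h, A.cls_eq_cls]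
  simp only [single_mul_onePlusPow]
  rw [A.star_of_mem_intCast ha, A.star_of_mem_intCast hb]
  simp only [Nat.cast_zero, sub_zero, zero_add, add_zero]
  -- The split-off term i = 0 is a*(b*c). All remaining terms, in both sums, carry a pole z^{-2-i}
  -- and lie in O(V).
  rw [add_right_comm, add_sub_cancel_right]
  refine add_mem (sum_mem fun i _ => ?_) (sum_mem fun i _ => ?_)
  · convert A.smear_intCast_mem_zhuO ha i _ using 5
    push_cast
    ring
  · convert A.smear_intCast_mem_zhuO hb i _ using 5
    ring

end CGradedVertexAlgebra

/-! ### The algebra A(V) and its filtration -/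

namespace CGradedVertexAlgebra

open LaurentSeries VertexAlgebra

variable {V : Type*} [AddCommGroup V] [Module ℂ V] (A : CGradedVertexAlgebra V)

/-- The product on `A(V)` induced by `*`. -/
noncomputable def zhuMul : A.Zhu →ₗ[ℂ] A.Zhu →ₗ[ℂ] A.Zhu :=
  (A.zhuO.liftQ (A.zhuO.liftQ (A.star.compr₂ A.zhuO.mkQ) fun x hx => LinearMap.ext fun v =>
    (Submodule.Quotient.mk_eq_zero _).2 (A.star_mem_zhuO_left hx v)).flip fun x hx => by
      ext u
      exact (Submodule.Quotient.mk_eq_zero _).2 (A.star_mem_zhuO_right u hx)).flip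

theorem zhuMul_cls (u v : V) : A.zhuMul (A.cls u) (A.cls v) = A.cls (A.star u v) := rfl

theorem cls_induction {P : A.Zhu → Prop} (a : A.Zhu)
    (hom : ∀ n : ℤ, ∀ v ∈ A.wt n, P (A.cls v)) (zero : P 0)
    (add : ∀ a b, P a → P b → P (a + b)) : P a := by
  obtain ⟨v, rfl⟩ := A.zhuO.mkQ_surjective a
  induction v using A.homogeneous_induction with
  | zero => simpa using zero
  | add v w hv hw =>
    rw [map_add]
    exact add _ _ hv hw
  | hom lam v hv =>
    by_cases h : ∀ n : ℤ, lam ≠ n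
    · rw [Submodule.mkQ_apply, (Submodule.Quotient.mk_eq_zero _).2 (A.wt_le_zhuO h hv)]
      exact zero
    · push Not at h
      obtain ⟨n, rfl⟩ := h
      exact hom n v hv

theorem zhuMul_assoc (a b c : A.Zhu) :
    A.zhuMul (A.zhuMul a b) c = A.zhuMul a (A.zhuMul b c) := by
  obtain ⟨w, rfl⟩ := A.zhuO.mkQ_surjective c
  induction a using A.cls_induction with
  | zero => simp
  | add a a' h h' => simp only [map_add, LinearMap.add_apply, h, h']
  | hom s u hu =>
    induction b using A.cls_induction with
    | zero => simp
    | add b b' h h' => simp only [map_add, LinearMap.add_apply, h, h']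
    | hom t v hv =>
      change A.zhuMul (A.zhuMul _ _) (A.cls w) = A.zhuMul _ (A.zhuMul _ (A.cls w))
      simp only [zhuMul_cls]
      exact A.cls_star_assoc hu hv w

theorem vac_mem_intCast : A.vac ∈ A.wt ((0 : ℤ) : ℂ) := by
  simpa using A.vac_mem

theorem vac_zhuMul (a : A.Zhu) : A.zhuMul (A.cls A.vac) a = a := by
  obtain ⟨w, rfl⟩ := A.zhuO.mkQ_surjective a
  refine (A.zhuMul_cls _ _).trans ?_
  rw [A.star_of_mem_intCast A.vac_mem_intCast, onePlusPow_zero, smear_single, mode_vac,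
    if_pos rfl]

theorem zhuMul_vac (a : A.Zhu) : A.zhuMul a (A.cls A.vac) = a := by
  induction a using A.cls_induction with
  | zero => simp
  | add a a' h h' => simp only [map_add, LinearMap.add_apply, h, h']
  | hom s u hu =>
    rw [zhuMul_cls, A.star_of_mem_intCast hu, A.smear_onePlusPow_eq_sum _ _ _ _ 1
      fun n hn => A.creation_nonneg u n (by simpa using hn)]
    have h₂ : A.mode u (-1) A.vac = u := A.creation_neg_one u
    simp [h₂]

theorem fil_le {t : ℕ} {W : Submodule ℂ A.Zhu}
    (h : ∀ j ≤ t, ∀ v ∈ A.wt (j : ℂ), A.cls v ∈ W) : A.fil t ≤ W := by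
  rw [fil, Submodule.map_le_iff_le_comap]
  exact iSup₂_le fun j hj v hv => h j hj v hv

theorem cls_mem_fil_of_le {j t : ℕ} (h : j ≤ t) {v : V} (hv : v ∈ A.wt (j : ℂ)) :
    A.cls v ∈ A.fil t :=
  Submodule.mem_map_of_mem (Submodule.mem_iSup_of_mem j (Submodule.mem_iSup_of_mem h hv))

theorem fil_mono : Monotone A.fil := fun _ _ hst =>
  A.fil_le fun _ hj _ hv => A.cls_mem_fil_of_le (hj.trans hst) hv

/-- Every integral weight space lies in V^0, hence in the sum of the V_n with n ≥ 0, which V_k meets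
trivially by directness of the grading. -/
theorem wt_eq_bot_of_neg (hV0 : A.part 0 = ⨆ n : ℕ, A.wt (n : ℂ)) {k : ℤ} (hk : k < 0) :
    A.wt k = ⊥ := by
  have h := A.isInternal.submodule_iSupIndep (k : ℂ)
  rw [disjoint_iff_inf_le] at h
  refine le_bot_iff.1 (le_trans (le_inf le_rfl ?_) h)
  have h₁ : A.wt k ≤ A.part 0 := fun x hx => Submodule.subset_span ⟨k, hx, by simp⟩
  refine h₁.trans (hV0.le.trans (iSup_le fun n => le_iSup₂_of_le (n : ℂ) ?_ le_rfl))
  intro h₂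
  have h₃ : (n : ℤ) = k := by exact_mod_cast h₂
  omega

theorem cls_mem_fil (hV0 : A.part 0 = ⨆ n : ℕ, A.wt (n : ℂ)) {k : ℤ} {t : ℕ} (h : k ≤ t) {v : V}
    (hv : v ∈ A.wt k) : A.cls v ∈ A.fil t := by
  rcases lt_or_ge k 0 with hk | hk
  · rw [A.wt_eq_bot_of_neg hV0 hk, Submodule.mem_bot] at hv
    rw [hv, cls, map_zero]
    exact zero_mem _
  · lift k to ℕ using hk
    exact A.cls_mem_fil_of_le (by exact_mod_cast h) (by simpa using hv)

theorem cls_mem_filPred (hV0 : A.part 0 = ⨆ n : ℕ, A.wt (n : ℂ)) {k : ℤ} {t : ℕ} (h : k < t)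
    {v : V} (hv : v ∈ A.wt k) : A.cls v ∈ A.filPred t := by
  cases t with
  | zero =>
    rw [A.wt_eq_bot_of_neg hV0 (by simpa using h), Submodule.mem_bot] at hv
    rw [hv, cls, map_zero]
    exact zero_mem _
  | succ t => exact A.cls_mem_fil hV0 (by push_cast at h; omega) hv

theorem iSup_fil (hV0 : A.part 0 = ⨆ n : ℕ, A.wt (n : ℂ)) : ⨆ t : ℕ, A.fil t = ⊤ := by
  rw [eq_top_iff]
  intro a _
  induction a using A.cls_induction with
  | zero => exact zero_mem _
  | add a a' h h' => exact add_mem (h trivial) (h' trivial)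
  | hom s u hu => exact Submodule.mem_iSup_of_mem s.toNat (A.cls_mem_fil hV0 (by omega) hu)

theorem mode_mem_intCast {i j : ℕ} {x y : V} (hx : x ∈ A.wt (i : ℂ)) (hy : y ∈ A.wt (j : ℂ))
    (n : ℤ) : A.mode x n y ∈ A.wt ((i + j - n - 1 : ℤ) : ℂ) := by
  convert A.mode_mem _ _ n _ _ hx hy using 2
  push_cast
  ring

theorem zhuMul_mem_fil (hV0 : A.part 0 = ⨆ n : ℕ, A.wt (n : ℂ)) (s t : ℕ) (a b : A.Zhu)
    (ha : a ∈ A.fil s) (hb : b ∈ A.fil t) : A.zhuMul a b ∈ A.fil (s + t) := by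
  suffices h : A.fil s ≤ (A.fil (s + t)).comap (A.zhuMul.flip b) from h ha
  refine A.fil_le fun i hi x hx => ?_
  suffices h : A.fil t ≤ (A.fil (s + t)).comap (A.zhuMul (A.cls x)) from h hb
  refine A.fil_le fun j hj y hy => ?_
  rw [Submodule.mem_comap, zhuMul_cls, A.star_of_mem_intCast (n := i) (by simpa using hx)]
  refine A.smear_mem ((A.fil (s + t)).comap A.zhuO.mkQ) fun n hn => ?_
  refine A.cls_mem_fil hV0 ?_ (A.mode_mem_intCast hx hy n)
  have : -1 ≤ n := not_lt.1 fun h => hn (coeff_onePlusPow_of_lt h)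
  push_cast
  omega

theorem zhuMul_sub_mem_filPred (hV0 : A.part 0 = ⨆ n : ℕ, A.wt (n : ℂ)) (s t : ℕ) (a b : A.Zhu)
    (ha : a ∈ A.fil s) (hb : b ∈ A.fil t) :
    A.zhuMul a b - A.zhuMul b a ∈ A.filPred (s + t) := by
  suffices h : A.fil s ≤ (A.filPred (s + t)).comap (A.zhuMul.flip b - A.zhuMul b) from h ha
  refine A.fil_le fun i hi x hx => ?_
  suffices h : A.fil t ≤ (A.filPred (s + t)).comap (A.zhuMul (A.cls x) - A.zhuMul.flip (A.cls x))
    from h hb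
  refine A.fil_le fun j hj y hy => ?_
  change A.zhuMul (A.cls x) (A.cls y) - A.zhuMul (A.cls y) (A.cls x) ∈ A.filPred (s + t)
  have hx' : x ∈ A.wt ((i : ℤ) : ℂ) := by simpa using hx
  have hy' : y ∈ A.wt ((j : ℤ) : ℂ) := by simpa using hy
  rw [zhuMul_cls, zhuMul_cls, A.cls_star_sub_star hx' hy', cls, map_sub, sub_sub_cancel_left]
  refine neg_mem (A.smear_mem ((A.filPred (s + t)).comap A.zhuO.mkQ) fun n hn => ?_)
  refine A.cls_mem_filPred hV0 ?_ (A.mode_mem_intCast hy hx n)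
  have : 0 ≤ n := not_lt.1 fun h => hn (coeff_onePlusPow_of_lt h)
  push_cast
  omega

/-- The class in `gr_t A(V)` of an element of `F_t A(V)`. -/
noncomputable abbrev grCls (t : ℕ) : A.fil t →ₗ[ℂ] A.grPiece t :=
  ((A.filPred t).comap (A.fil t).subtype).mkQ

theorem grCls_eq_zero {t : ℕ} {a : A.fil t} (h : (a : A.Zhu) ∈ A.filPred t) : A.grCls t a = 0 :=
  (Submodule.Quotient.mk_eq_zero _).2 h

theorem symb_eq_symb {t : ℕ} {a b : A.fil t} (h : (a : A.Zhu) - b ∈ A.filPred t) :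
    A.symb t a = A.symb t b :=
  congrArg (DirectSum.lof ℂ ℕ A.grPiece t)
    ((Submodule.Quotient.eq ((A.filPred t).comap (A.fil t).subtype)).2 h)

/-- Degrees such as (r+s)+t and r+(s+t) index different types; comparing inside gr A(V) avoids
casts. -/
theorem symb_congr {s t : ℕ} (hst : s = t) {a : A.fil s} {b : A.fil t}
    (h : (a : A.Zhu) = b) : A.symb s a = A.symb t b := by
  subst hst
  rw [Subtype.ext h]

theorem gr_induction {P : A.gr → Prop} (x : A.gr) (symb : ∀ t (a : A.fil t), P (A.symb t a))
    (add : ∀ x y, P x → P y → P (x + y)) : P x := by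
  induction x using DirectSum.induction_on with
  | zero => simpa [CGradedVertexAlgebra.symb] using symb 0 0
  | of t p =>
    obtain ⟨a, rfl⟩ := Submodule.mkQ_surjective _ p
    exact symb t a
  | add x y hx hy => exact add x y hx hy

/-! ### The product on the associated graded space -/

section

variable (mul : A.Zhu →ₗ[ℂ] A.Zhu →ₗ[ℂ] A.Zhu)
  (hmul : ∀ (s t : ℕ) (a b : A.Zhu), a ∈ A.fil s → b ∈ A.fil t → mul a b ∈ A.fil (s + t))

/-- Makes the graded product independent of representatives; the case s = 0 is F_{-1} A(V) = 0. -/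
theorem mul_mem_filPred_left
    (hmul : ∀ (s t : ℕ) (a b : A.Zhu), a ∈ A.fil s → b ∈ A.fil t → mul a b ∈ A.fil (s + t))
    {s t : ℕ} {a b : A.Zhu} (ha : a ∈ A.filPred s) (hb : b ∈ A.fil t) :
    mul a b ∈ A.filPred (s + t) := by
  cases s with
  | zero =>
    rw [(Submodule.mem_bot ℂ).1 ha, map_zero, LinearMap.zero_apply]
    exact zero_mem _
  | succ s =>
    rw [Nat.succ_add]
    exact hmul s t a b ha hb

theorem mul_mem_filPred_right
    (hmul : ∀ (s t : ℕ) (a b : A.Zhu), a ∈ A.fil s → b ∈ A.fil t → mul a b ∈ A.fil (s + t))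
    {s t : ℕ} {a b : A.Zhu} (ha : a ∈ A.fil s) (hb : b ∈ A.filPred t) :
    mul a b ∈ A.filPred (s + t) := by
  cases t with
  | zero =>
    rw [(Submodule.mem_bot ℂ).1 hb, map_zero]
    exact zero_mem _
  | succ t => exact hmul s t a b ha hb

/-- The product `F_s A(V) × F_t A(V) → gr_{s+t} A(V)` induced by a filtered product. -/
noncomputable def filMul (s t : ℕ) : A.fil s →ₗ[ℂ] A.fil t →ₗ[ℂ] A.grPiece (s + t) :=
  LinearMap.mk₂ ℂ (fun a b => A.grCls (s + t) ⟨mul a b, hmul s t a b a.2 b.2⟩)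
    (fun a a' b => by
      rw [← map_add]
      exact congrArg _ (Subtype.ext (by simp)))
    (fun c a b => by
      rw [← map_smul]
      exact congrArg _ (Subtype.ext (by simp)))
    (fun a b b' => by
      rw [← map_add]
      exact congrArg _ (Subtype.ext (by simp)))
    (fun c a b => by
      rw [← map_smul]
      exact congrArg _ (Subtype.ext (by simp)))

/-- The product `gr_s A(V) × gr_t A(V) → gr_{s+t} A(V)` induced by a filtered product. -/
noncomputable def grPieceMul (s t : ℕ) :
    A.grPiece s →ₗ[ℂ] A.grPiece t →ₗ[ℂ] A.grPiece (s + t) :=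
  (Submodule.liftQ ((A.filPred t).comap (A.fil t).subtype)
    (Submodule.liftQ ((A.filPred s).comap (A.fil s).subtype) (A.filMul mul hmul s t) fun a ha =>
      LinearMap.ext fun b => A.grCls_eq_zero (A.mul_mem_filPred_left mul hmul ha b.2)).flip
    fun b hb => by
      ext a
      exact A.grCls_eq_zero (A.mul_mem_filPred_right mul hmul a.2 hb)).flip

/-- The product on `gr A(V)` induced by a filtered product. -/
noncomputable def grMul : A.gr →ₗ[ℂ] A.gr →ₗ[ℂ] A.gr :=
  DirectSum.toModule ℂ ℕ _ fun s => (DirectSum.toModule ℂ ℕ _ fun t =>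
    ((A.grPieceMul mul hmul s t).compr₂ (DirectSum.lof ℂ ℕ A.grPiece (s + t))).flip).flip

theorem grMul_symb (s t : ℕ) (a : A.fil s) (b : A.fil t) :
    A.grMul mul hmul (A.symb s a) (A.symb t b) =
      A.symb (s + t) ⟨mul a b, hmul s t a b a.2 b.2⟩ := by
  rw [grMul, symb, symb, DirectSum.toModule_lof, LinearMap.flip_apply, DirectSum.toModule_lof]
  rfl

theorem grMul_assoc (h : ∀ a b c, mul (mul a b) c = mul a (mul b c)) (x y z : A.gr) :
    A.grMul mul hmul (A.grMul mul hmul x y) z = A.grMul mul hmul x (A.grMul mul hmul y z) := by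
  induction x using A.gr_induction with
  | add x x' hx hx' => simp only [map_add, LinearMap.add_apply, hx, hx']
  | symb r a =>
    induction y using A.gr_induction with
    | add y y' hy hy' => simp only [map_add, LinearMap.add_apply, hy, hy']
    | symb s b =>
      induction z using A.gr_induction with
      | add z z' hz hz' => simp only [map_add, hz, hz']
      | symb t c =>
        simp only [grMul_symb]
        exact A.symb_congr (add_assoc r s t) (h a b c)

theorem grMul_comm (h : ∀ (s t : ℕ) (a b : A.Zhu), a ∈ A.fil s → b ∈ A.fil t →
    mul a b - mul b a ∈ A.filPred (s + t)) (x y : A.gr) :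
    A.grMul mul hmul x y = A.grMul mul hmul y x := by
  induction x using A.gr_induction with
  | add x x' hx hx' => simp only [map_add, LinearMap.add_apply, hx, hx']
  | symb s a =>
    induction y using A.gr_induction with
    | add y y' hy hy' => simp only [map_add, LinearMap.add_apply, hy, hy']
    | symb t b =>
      rw [grMul_symb, grMul_symb, A.symb_congr (add_comm t s)
        (b := ⟨mul b a, add_comm t s ▸ hmul t s b a b.2 a.2⟩) rfl]
      exact A.symb_eq_symb (h s t a b a.2 b.2)

theorem one_grMul {e : A.Zhu} (he : e ∈ A.fil 0) (h : ∀ a, mul e a = a) (x : A.gr) :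
    A.grMul mul hmul (A.symb 0 ⟨e, he⟩) x = x := by
  induction x using A.gr_induction with
  | add x x' hx hx' => rw [map_add, hx, hx']
  | symb t a =>
    rw [grMul_symb]
    exact A.symb_congr (zero_add t) (h a)

end

end CGradedVertexAlgebra

theorem mainTheorem8 {V : Type*} [AddCommGroup V] [Module ℂ V] (A : CGradedVertexAlgebra V)
    (hA : A.IsOmegaGeneratedReGraded)
    (hV0 : A.part 0 = ⨆ n : ℕ, A.wt (n : ℂ)) :
    -- `*` descends to `A(V)` and makes it an associative algebra with unit `[𝟏]`
    ∃ mul : A.Zhu →ₗ[ℂ] A.Zhu →ₗ[ℂ] A.Zhu,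
      (∀ u v : V, mul (A.cls u) (A.cls v) = A.cls (A.star u v)) ∧
      (∀ a b c : A.Zhu, mul (mul a b) c = mul a (mul b c)) ∧
      (∀ a : A.Zhu, mul (A.cls A.vac) a = a ∧ mul a (A.cls A.vac) = a) ∧
      -- `F_t A(V)` is an increasing exhaustive filtration
      Monotone A.fil ∧ (⨆ t : ℕ, A.fil t) = ⊤ ∧
      -- it is multiplicative
      ∃ hmul : ∀ (s t : ℕ) (a b : A.Zhu), a ∈ A.fil s → b ∈ A.fil t → mul a b ∈ A.fil (s + t),
      -- the induced product on `gr A(V)` is well defined, associative, commutative and unital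
      ∃ grMul : A.gr →ₗ[ℂ] A.gr →ₗ[ℂ] A.gr,
        (∀ (s t : ℕ) (a : A.fil s) (b : A.fil t),
          grMul (A.symb s a) (A.symb t b) =
            A.symb (s + t) ⟨mul a b, hmul s t a b a.2 b.2⟩) ∧
        (∀ x y z : A.gr, grMul (grMul x y) z = grMul x (grMul y z)) ∧
        (∀ x y : A.gr, grMul x y = grMul y x) ∧
        (∀ x : A.gr, grMul (A.symb 0 ⟨A.cls A.vac, A.cls_vac_mem⟩) x = x) := by
  have hmul := A.zhuMul_mem_fil hV0
  exact ⟨A.zhuMul, A.zhuMul_cls, A.zhuMul_assoc, fun a => ⟨A.vac_zhuMul a, A.zhuMul_vac a⟩,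
    A.fil_mono, A.iSup_fil hV0, hmul, A.grMul A.zhuMul hmul, A.grMul_symb A.zhuMul hmul,
    A.grMul_assoc A.zhuMul hmul A.zhuMul_assoc,
    A.grMul_comm A.zhuMul hmul (A.zhuMul_sub_mem_filPred hV0),
    A.one_grMul A.zhuMul hmul A.cls_vac_mem A.vac_zhuMul⟩
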